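/- Let $n\ge 3$ and $k\ge 1$. Let $P_1,\dots,P_k$ be tangential hyperbolic $n$-gons, i.e. convex polygons with $n$ vertices in the hyperbolic plane (of curvature $-1$; no interior angle equal to $\pi$), each having an inscribed circle, that is, a circle of positive radius which bounds a disc contained in the polygon and is tangent to all $n$ sides. Let $r(P_i)$ be the inradius of $P_i$, i.e. the radius of its inscribed circle, and let $T=\sum_{i=1}^k r(P_i)$ be the total inradius. Then $\sin(\pi/n)\cosh(T/k)\le 1$ and $$\sum_{i=1}^k \operatorname{Area}(P_i)\;\ge\; k(n-2)\pi-2nk\,\cos^{-1}\!\bigl(\sin(\pi/n)\cosh(T/k)\bigr),$$ where $\operatorname{Area}$ is the hyperbolic area. Equality holds if and only if every $P_i$ is regular (all its sides have equal length and all its interior angles are equal) with inradius $r(P_i)=T/k$. -/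

import Mathlib

open UpperHalfPlane MeasureTheory

/-! The hyperbolic plane is the upper half-plane `ℍ` with Mathlib's hyperbolic distance and Mathlib's
hyperbolic area measure `dx dy / y ^ 2`. -/

namespace Hyperbolic

noncomputable section

/-- For `a ≠ b`, the equation `side a b z = 0` in `z` is of the form `α + β x + γ (x² + y²) = 0` and is
that of the complete geodesic (vertical line, or half-circle centred on the real axis) through `a`
and `b`. The sign of `side a b z` tells on which side of this geodesic the point `z` lies. -/
def side (a b z : ℍ) : ℝ :=
  (b.re - a.re) * (Complex.normSq (z : ℂ) - Complex.normSq (a : ℂ)) -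
    (z.re - a.re) * (Complex.normSq (b : ℂ) - Complex.normSq (a : ℂ))

/-- The complete geodesic through two distinct points `a` and `b`. -/
def geodesicLine (a b : ℍ) : Set ℍ := {z | side a b z = 0}

/-- The geodesic segment with endpoints `a` and `b`. -/
def geodesicSegment (a b : ℍ) : Set ℍ := {z | dist a z + dist z b = dist a b}

/-- The image of `w` under the Cayley transform, a conformal map of the upper half-plane onto the unit
disc, that sends `z` to the centre `0` (and so sends the geodesics through `z` to diameters). -/
def toDisc (z w : ℍ) : ℂ := ((w : ℂ) - (z : ℂ)) / ((w : ℂ) - (starRingEnd ℂ) (z : ℂ))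

/-- The angle at `z`, in `[0, π]`, between the geodesic segments from `z` to `u` and from `z` to `w`. -/
def angleAt (z u w : ℍ) : ℝ := InnerProductGeometry.angle (toDisc z u) (toDisc z w)

variable {n : ℕ}

/-- The vertices `P 0, …, P (n - 1)` are, in this cyclic order (of either orientation), the vertices of a
convex `n`-gon, no vertex angle being straight: for every side, all the vertices that are not
endpoints of this side lie strictly on one side of the geodesic that carries it. -/
def IsConvexPolygon (P : Polygon ℍ n) : Prop :=
  3 ≤ n ∧ ∀ i j k : Fin n, j ≠ i → j ≠ finRotate n i → k ≠ i → k ≠ finRotate n i →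
    0 < side (P i) (P (finRotate n i)) (P j) * side (P i) (P (finRotate n i)) (P k)

/-- The closed region bounded by a convex polygon: the intersection of the closed half-planes that are
bounded by the geodesics carrying the sides and contain the vertices. -/
def region (P : Polygon ℍ n) : Set ℍ :=
  {z | ∀ i j : Fin n,
    0 ≤ side (P i) (P (finRotate n i)) z * side (P i) (P (finRotate n i)) (P j)}

/-- The hyperbolic area of a convex polygon. -/
def area (P : Polygon ℍ n) : ℝ := (volume : Measure ℍ).real (region P)

/-- The length of the `i`-th side, the one from vertex `i` to the next vertex. -/
def sideLength (P : Polygon ℍ n) (i : Fin n) : ℝ := dist (P i) (P (finRotate n i))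

/-- The interior angle of a convex polygon at vertex `i`. -/
def interiorAngle (P : Polygon ℍ n) (i : Fin n) : ℝ :=
  angleAt (P i) (P ((finRotate n).symm i)) (P (finRotate n i))

/-- A convex polygon is regular if its sides have equal lengths and its interior angles are equal. -/
def IsRegular (P : Polygon ℍ n) : Prop :=
  (∀ i j, sideLength P i = sideLength P j) ∧ ∀ i j, interiorAngle P i = interiorAngle P j

/-- The circle with centre `c` and radius `r` is inscribed in the convex polygon `P`: it bounds a disc
contained in `P` and is tangent to every side. -/
def IsIncircle (P : Polygon ℍ n) (c : ℍ) (r : ℝ) : Prop :=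
  0 < r ∧ Metric.closedBall c r ⊆ region P ∧
    ∀ i, ∃ p ∈ geodesicSegment (P i) (P (finRotate n i)),
      geodesicLine (P i) (P (finRotate n i)) ∩ Metric.closedBall c r = {p}

/-- `P` is a tangential hyperbolic `n`-gon with inradius `r`. -/
def IsTangentialWithInradius (P : Polygon ℍ n) (r : ℝ) : Prop :=
  IsConvexPolygon P ∧ ∃ c, IsIncircle P c r

end

end Hyperbolic

/-! In the Klein model centred at the incentre, geodesics are straight chords and the incircle is a
Euclidean circle of radius `tanh r`. A tangential polygon thus becomes a Euclidean polygon
circumscribed about a circle centred at the origin (`exists_isCircumscribed`). Joining the centre to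
the vertices and to the points of tangency cuts it into right triangles with leg `r`, two for each
vertex, congruent and with the same angle `θ i` at the centre, so `∑ θ i = π`.

Such a triangle has a third angle `β` with `cos β = sin (θ i) * cosh r`, so its area is `π / 2 - θ i
- β = arcsin (sin (θ i) * cosh r) - θ i`, and the polygon has area `2 * ∑ arcsin (sin (θ i) * cosh
r) - 2 * π`. The area and the angle sum are both obtained by integrating over directions at the
centre, split by the side that a ray meets first (`setLIntegral_eq_sum`, `volume_eq_sum`).

Two applications of Jensen then suffice. For fixed `r > 0`, `arcsin (sin θ * cosh r)` is strictly
convex in `θ`, so equal angles `π / n` minimise the area. For fixed `s = sin (π / n)`, `arcsin (s *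
cosh r)` is strictly convex in `r`, so equal inradii minimise the sum. Strictness gives the equality
case, because a tangential polygon is regular exactly when its `θ i` agree (`isRegular_iff`). -/

namespace Hyperbolic

noncomputable section

section

/-! ### Klein coordinates centred at a point -/

/-- The common denominator of the Klein coordinates of `z` centred at `c`. -/
def kleinDen (c z : ℍ) : ℝ := (z.re - c.re) ^ 2 + z.im ^ 2 + c.im ^ 2

/-- The first Klein coordinate of `z`, in the Klein model centred at `c`. -/
def kleinX (c z : ℍ) : ℝ := 2 * c.im * (z.re - c.re) / kleinDen c z

/-- The second Klein coordinate of `z`, in the Klein model centred at `c`. -/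
def kleinY (c z : ℍ) : ℝ := ((z.re - c.re) ^ 2 + z.im ^ 2 - c.im ^ 2) / kleinDen c z

lemma kleinDen_pos (c z : ℍ) : 0 < kleinDen c z := by
  have := z.im_pos
  unfold kleinDen; positivity

lemma kleinDen_ne_zero (c z : ℍ) : kleinDen c z ≠ 0 := (kleinDen_pos c z).ne'

lemma cosh_dist_eq (z w : ℍ) :
    Real.cosh (dist z w) = ((z.re - w.re) ^ 2 + z.im ^ 2 + w.im ^ 2) / (2 * z.im * w.im) := by
  have h1 := z.im_pos
  have h2 := w.im_pos
  rw [UpperHalfPlane.cosh_dist, Complex.dist_eq, ← Complex.normSq_eq_norm_sq, Complex.normSq_apply]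
  simp only [Complex.sub_re, Complex.sub_im, coe_re, coe_im]
  field_simp
  ring

lemma cosh_dist_center (c z : ℍ) : Real.cosh (dist c z) = kleinDen c z / (2 * c.im * z.im) := by
  rw [cosh_dist_eq, kleinDen]; ring

/-- This is the Minkowski product of the hyperboloid model: `cosh (dist c z) * (1, kleinX, kleinY)`
is the point of the hyperboloid over `z`. Every later distance computation goes through it. -/
lemma cosh_dist_klein (c z w : ℍ) :
    Real.cosh (dist z w) = Real.cosh (dist c z) * Real.cosh (dist c w) *
      (1 - (kleinX c z * kleinX c w + kleinY c z * kleinY c w)) := by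
  have h1 := z.im_pos
  have h2 := w.im_pos
  have h3 := c.im_pos
  have h4 := kleinDen_ne_zero c z
  have h5 := kleinDen_ne_zero c w
  rw [cosh_dist_center, cosh_dist_center, cosh_dist_eq, kleinX, kleinX, kleinY, kleinY]
  field_simp
  unfold kleinDen
  ring

lemma klein_sq (c z : ℍ) :
    kleinX c z ^ 2 + kleinY c z ^ 2 = 1 - 1 / Real.cosh (dist c z) ^ 2 := by
  have h1 := z.im_pos
  have h3 := c.im_pos
  have h4 := kleinDen_ne_zero c z
  rw [cosh_dist_center, kleinX, kleinY]
  field_simp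
  unfold kleinDen
  ring

lemma klein_sq_lt_one (c z : ℍ) : kleinX c z ^ 2 + kleinY c z ^ 2 < 1 := by
  rw [klein_sq]
  have := Real.cosh_pos (dist c z)
  have : 0 < 1 / Real.cosh (dist c z) ^ 2 := by positivity
  linarith

lemma tanh_sq (r : ℝ) : Real.tanh r ^ 2 = 1 - 1 / Real.cosh r ^ 2 := by
  have h := Real.cosh_pos r
  rw [Real.tanh_eq_sinh_div_cosh, div_pow, Real.sinh_sq]
  field_simp

lemma mem_closedBall_iff_klein {c z : ℍ} {r : ℝ} (hr : 0 ≤ r) :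
    z ∈ Metric.closedBall c r ↔ kleinX c z ^ 2 + kleinY c z ^ 2 ≤ Real.tanh r ^ 2 := by
  have h1 := Real.cosh_pos (dist c z)
  have h2 := Real.cosh_pos r
  rw [klein_sq, tanh_sq, Metric.mem_closedBall, dist_comm, sub_le_sub_iff_left,
    one_div_le_one_div (by positivity) (by positivity), sq_le_sq₀ h1.le h2.le, Real.cosh_le_cosh,
    abs_of_nonneg dist_nonneg, abs_of_nonneg hr]

lemma klein_self (c : ℍ) : kleinX c c = 0 ∧ kleinY c c = 0 := by
  simp [kleinX, kleinY]

/-- Equal coordinates force equal distances to `c`, and the product formula then gives `cosh (dist z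
w) = 1`. -/
lemma klein_injective {c z w : ℍ} (hx : kleinX c z = kleinX c w) (hy : kleinY c z = kleinY c w) :
    z = w := by
  have h := cosh_dist_klein c z w
  have h1 := klein_sq c z
  have h2 := klein_sq c w
  rw [← hx, ← hy] at h h2
  have h3 := Real.cosh_pos (dist c z)
  have h4 := Real.cosh_pos (dist c w)
  have h5 : Real.cosh (dist c z) = Real.cosh (dist c w) := by
    rw [h1, sub_right_inj, div_eq_div_iff (by positivity) (by positivity), one_mul, one_mul,
      sq_eq_sq₀ h4.le h3.le] at h2
    exact h2.symm
  have h6 : Real.cosh (dist z w) = 1 := by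
    rw [h, ← h5, ← sq, ← sq, ← sq, h1]
    field_simp
    ring
  by_contra hne
  have := Real.one_lt_cosh.2 (dist_pos.2 hne).ne'
  linarith

lemma exists_klein_eq (c : ℍ) {u v : ℝ} (h : u ^ 2 + v ^ 2 < 1) :
    ∃ z, kleinX c z = u ∧ kleinY c z = v := by
  have hb := c.im_pos
  obtain ⟨s, hs, hs2⟩ : ∃ s, 0 < s ∧ s ^ 2 = 1 - u ^ 2 - v ^ 2 :=
    ⟨√(1 - u ^ 2 - v ^ 2), Real.sqrt_pos.2 (by linarith), Real.sq_sqrt (by linarith)⟩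
  have hv : 0 < 1 - v := by nlinarith
  -- The inverse of the Klein map, with `s` playing the role of `1 / cosh (dist c z)`.
  refine ⟨⟨⟨c.re + c.im * u / (1 - v), c.im * s / (1 - v)⟩, by positivity⟩, ?_⟩
  have hN : (c.im * u / (1 - v)) ^ 2 + (c.im * s / (1 - v)) ^ 2 + c.im ^ 2 =
      2 * c.im ^ 2 / (1 - v) := by
    field_simp
    linear_combination hs2
  simp only [kleinX, kleinY, kleinDen, mk_re, mk_im, add_sub_cancel_left, hN]
  constructor
  · field_simp
  · field_simp
    linear_combination hs2

/-- The cross product of `b - a` and `z - a` in Klein coordinates. -/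
lemma side_klein (c a b z : ℍ) :
    4 * c.im ^ 3 * side a b z = kleinDen c a * kleinDen c b * kleinDen c z *
      ((kleinX c b - kleinX c a) * (kleinY c z - kleinY c a) -
        (kleinX c z - kleinX c a) * (kleinY c b - kleinY c a)) := by
  have h1 := kleinDen_ne_zero c a
  have h2 := kleinDen_ne_zero c b
  have h3 := kleinDen_ne_zero c z
  simp only [side, kleinX, kleinY, Complex.normSq_apply, coe_re, coe_im]
  field_simp
  unfold kleinDen
  ring

/-- The norm in the disc is `tanh (d / 2)` and the remaining factor is `2 * cosh (d / 2) ^ 2`, where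
`d = dist z u`. This links angles, defined through the disc, to distances. -/
lemma sinh_dist_eq (z u : ℍ) :
    Real.sinh (dist z u) =
      ‖toDisc z u‖ * Complex.normSq ((u : ℂ) - (starRingEnd ℂ) (z : ℂ)) / (2 * z.im * u.im) := by
  have h1 := z.im_pos
  have h2 := u.im_pos
  have h0 : 0 < Complex.normSq ((u : ℂ) - (starRingEnd ℂ) (z : ℂ)) := by
    simp only [Complex.normSq_apply, Complex.sub_re, Complex.sub_im, Complex.conj_re,
      Complex.conj_im, coe_re, coe_im]
    nlinarith [mul_self_nonneg (u.re - z.re)]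
  rw [← sq_eq_sq₀ (Real.sinh_nonneg_iff.2 dist_nonneg) (by positivity), Real.sinh_sq,
    cosh_dist_eq, toDisc]
  simp only [div_pow, mul_pow, ← Complex.normSq_eq_norm_sq, Complex.normSq_div]
  field_simp
  simp only [Complex.normSq_apply, Complex.sub_re, Complex.sub_im, Complex.conj_re,
      Complex.conj_im, coe_re, coe_im]
  ring

lemma toDisc_ne_zero {z u : ℍ} (hu : u ≠ z) : toDisc z u ≠ 0 := by
  refine div_ne_zero (sub_ne_zero.2 fun h ↦ hu (UpperHalfPlane.ext h)) fun h ↦ ?_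
  have := congrArg Complex.im h
  simp only [Complex.sub_im, Complex.conj_im, coe_im, Complex.zero_im] at this
  linarith [z.im_pos, u.im_pos]

/-- The hyperbolic law of cosines. -/
lemma cosh_dist_eq_angleAt {z u w : ℍ} (hu : u ≠ z) (hw : w ≠ z) :
    Real.cosh (dist u w) = Real.cosh (dist z u) * Real.cosh (dist z w) -
      Real.sinh (dist z u) * Real.sinh (dist z w) * Real.cos (angleAt z u w) := by
  have h1 := z.im_pos
  have h2 := u.im_pos
  have h3 := w.im_pos
  have h4 := norm_ne_zero_iff.2 (toDisc_ne_zero hu)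
  have h5 := norm_ne_zero_iff.2 (toDisc_ne_zero hw)
  have h6 : 0 < Complex.normSq ((u : ℂ) - (starRingEnd ℂ) (z : ℂ)) := by
    simp only [Complex.normSq_apply, Complex.sub_re, Complex.sub_im, Complex.conj_re,
      Complex.conj_im, coe_re, coe_im]
    nlinarith [mul_self_nonneg (u.re - z.re)]
  have h7 : 0 < Complex.normSq ((w : ℂ) - (starRingEnd ℂ) (z : ℂ)) := by
    simp only [Complex.normSq_apply, Complex.sub_re, Complex.sub_im, Complex.conj_re,
      Complex.conj_im, coe_re, coe_im]
    nlinarith [mul_self_nonneg (w.re - z.re)]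
  rw [angleAt, InnerProductGeometry.cos_angle, sinh_dist_eq, sinh_dist_eq, cosh_dist_eq,
    cosh_dist_eq, cosh_dist_eq, Complex.inner]
  field_simp
  simp only [toDisc, Complex.mul_re, Complex.conj_re, Complex.conj_im, Complex.div_re,
    Complex.div_im]
  field_simp
  simp only [Complex.sub_re, Complex.sub_im, Complex.conj_re, Complex.conj_im, coe_re, coe_im]
  ring

end

section

/-! ### The Euclidean polygon in the Klein model -/

/-- The points `(x i, y i)` of the open unit disc are the vertices of a convex polygon that is
circumscribed about the circle of radius `ρ` centred at the origin, the side from vertex `i` to the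
next one having the outer normal `(cos (φ i), sin (φ i))`. -/
structure IsCircumscribed {n : ℕ} (ρ : ℝ) (φ x y : Fin n → ℝ) : Prop where
  three_le : 3 ≤ n
  pos : 0 < ρ
  sq_lt_one : ∀ i, x i ^ 2 + y i ^ 2 < 1
  eq_left : ∀ i, Real.cos (φ i) * x i + Real.sin (φ i) * y i = ρ
  eq_right : ∀ i, Real.cos (φ i) * x (finRotate n i) + Real.sin (φ i) * y (finRotate n i) = ρ
  lt_of_ne : ∀ i j, j ≠ i → j ≠ finRotate n i →
    Real.cos (φ i) * x j + Real.sin (φ i) * y j < ρ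

lemma exists_ne_ne_finRotate {n : ℕ} (hn : 3 ≤ n) (i : Fin n) :
    ∃ j, j ≠ i ∧ j ≠ finRotate n i := by
  have h : ({i, finRotate n i} : Finset (Fin n)).card < (Finset.univ : Finset (Fin n)).card := by
    rw [Finset.card_univ, Fintype.card_fin]
    exact (Finset.card_le_two).trans_lt hn
  obtain ⟨j, -, hj⟩ := Finset.exists_mem_notMem_of_card_lt_card h
  refine ⟨j, ?_, ?_⟩ <;> rintro rfl <;> simp at hj

lemma tanh_pos {r : ℝ} (hr : 0 < r) : 0 < Real.tanh r := by
  rw [Real.tanh_eq_sinh_div_cosh]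
  exact div_pos (Real.sinh_pos_iff.2 hr) (Real.cosh_pos r)

/-- A line in the plane has an equation in normal form. -/
lemma exists_normal_form {a b : ℝ} (d : ℝ) (hab : a ≠ 0 ∨ b ≠ 0) :
    ∃ (ψ δ s : ℝ), 0 ≤ δ ∧ s ≠ 0 ∧
      ∀ X Y, a * X + b * Y - d = s * (δ - (Real.cos ψ * X + Real.sin ψ * Y)) := by
  have key : ∀ a b d : ℝ, (a ≠ 0 ∨ b ≠ 0) → 0 ≤ d → ∃ (ψ δ s : ℝ), 0 ≤ δ ∧ s ≠ 0 ∧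
      ∀ X Y, a * X + b * Y - d = s * (δ - (Real.cos ψ * X + Real.sin ψ * Y)) := by
    intro a b d hab hd
    have hz : (⟨a, b⟩ : ℂ) ≠ 0 := by
      intro h
      have h1 := congrArg Complex.re h
      have h2 := congrArg Complex.im h
      simp_all
    have hn : 0 < ‖(⟨a, b⟩ : ℂ)‖ := norm_pos_iff.2 hz
    refine ⟨Complex.arg ⟨a, b⟩, d / ‖(⟨a, b⟩ : ℂ)‖, -‖(⟨a, b⟩ : ℂ)‖, by positivity,
      by simpa using hz, fun X Y ↦ ?_⟩
    rw [Complex.cos_arg hz, Complex.sin_arg]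
    field_simp
    ring
  rcases le_total 0 d with hd | hd
  · exact key a b d hab hd
  · obtain ⟨ψ, δ, s, h1, h2, h3⟩ := key (-a) (-b) (-d) (by simpa using hab) (by linarith)
    exact ⟨ψ, δ, -s, h1, by simpa using h2, fun X Y ↦ by linear_combination -h3 X Y⟩

variable {n : ℕ}

/-- In the Klein model centred at the centre of the inscribed circle, each side has an equation in
normal form. -/
lemma exists_side_eq {P : Polygon ℍ n} {c : ℍ} {r : ℝ} (hP : IsConvexPolygon P)
    (hc : IsIncircle P c r) (i : Fin n) : ∃ ψ s : ℝ, s ≠ 0 ∧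
      ∀ z, ∃ t, 0 < t ∧ side (P i) (P (finRotate n i)) z =
        t * s * (Real.tanh r - (Real.cos ψ * kleinX c z + Real.sin ψ * kleinY c z)) := by
  obtain ⟨hr, hsub, htan⟩ := hc
  have hρ : 0 < Real.tanh r := tanh_pos hr
  obtain ⟨p, -, hp⟩ := htan i
  set a := P i with ha
  set b := P (finRotate n i) with hb
  obtain ⟨j, hj1, hj2⟩ := exists_ne_ne_finRotate hP.1 i
  have hside := hP.2 i j j hj1 hj2 hj1 hj2
  have hb3 : 0 < 4 * c.im ^ 3 := by have := c.im_pos; positivity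
  have hne : -(kleinY c b - kleinY c a) ≠ 0 ∨ (kleinX c b - kleinX c a) ≠ 0 := by
    by_contra! h
    have h1 := side_klein c a b (P j)
    rw [h.2, neg_eq_zero.1 h.1, zero_mul, mul_zero, sub_zero, mul_zero] at h1
    have h2 := (mul_eq_zero.1 h1).resolve_left hb3.ne'
    rw [← ha, ← hb, h2, zero_mul] at hside
    exact hside.false
  obtain ⟨ψ, δ, s, hδ, hs, h⟩ := exists_normal_form
    ((kleinX c b - kleinX c a) * kleinY c a - kleinX c a * (kleinY c b - kleinY c a)) hne
  have hform : ∀ z, ∃ t, 0 < t ∧ side a b z =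
      t * s * (δ - (Real.cos ψ * kleinX c z + Real.sin ψ * kleinY c z)) := by
    intro z
    refine ⟨kleinDen c a * kleinDen c b * kleinDen c z / (4 * c.im ^ 3), ?_, ?_⟩
    · have := kleinDen_pos c a
      have := kleinDen_pos c b
      have := kleinDen_pos c z
      positivity
    · have h1 := side_klein c a b z
      rw [mul_assoc, ← h (kleinX c z) (kleinY c z), div_mul_eq_mul_div, eq_div_iff hb3.ne']
      linear_combination h1
  have hzero : ∀ z, z ∈ geodesicLine a b ↔
      Real.cos ψ * kleinX c z + Real.sin ψ * kleinY c z = δ := by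
    intro z
    obtain ⟨t, ht, hz⟩ := hform z
    change side a b z = 0 ↔ _
    rw [hz, mul_eq_zero, or_iff_right (mul_ne_zero ht.ne' hs), sub_eq_zero, eq_comm]
  have hcs := Real.cos_sq_add_sin_sq ψ
  have hpm : p ∈ geodesicLine a b ∩ Metric.closedBall c r := by rw [hp]; rfl
  have hp1 := (hzero p).1 hpm.1
  have hp2 := (mem_closedBall_iff_klein hr.le).1 hpm.2
  -- Cauchy–Schwarz at the common point `p`: the line is at distance `δ` from the origin and meets
  -- the disc.
  have hle : δ ^ 2 ≤ Real.tanh r ^ 2 := by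
    nlinarith [sq_nonneg (Real.cos ψ * kleinY c p - Real.sin ψ * kleinX c p)]
  -- A line closer than `tanh r` would cut the disc in a chord of half-length `ε`. Both its ends
  -- would equal the unique common point `p`, forcing `sin ψ = cos ψ = 0`.
  have hδρ : δ = Real.tanh r := by
    by_contra hne
    have hlt : 0 < Real.tanh r ^ 2 - δ ^ 2 :=
      lt_of_le_of_ne (by linarith) fun h0 ↦ hne ((sq_eq_sq₀ hδ hρ.le).1 (by linarith))
    obtain ⟨ε, hε, hε2⟩ : ∃ ε, 0 < ε ∧ ε ^ 2 = Real.tanh r ^ 2 - δ ^ 2 :=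
      ⟨√(Real.tanh r ^ 2 - δ ^ 2), Real.sqrt_pos.2 hlt, Real.sq_sqrt hlt.le⟩
    have hpt : ∀ η : ℝ, η ^ 2 = ε ^ 2 → kleinX c p = δ * Real.cos ψ - η * Real.sin ψ ∧
        kleinY c p = δ * Real.sin ψ + η * Real.cos ψ := by
      intro η hη
      have hsq : (δ * Real.cos ψ - η * Real.sin ψ) ^ 2 + (δ * Real.sin ψ + η * Real.cos ψ) ^ 2 =
          Real.tanh r ^ 2 := by
        linear_combination (δ ^ 2 + η ^ 2) * hcs + hη + hε2
      obtain ⟨z, hz1, hz2⟩ := exists_klein_eq c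
        (hsq.trans_lt (by nlinarith [Real.tanh_lt_one r]))
      have : z ∈ geodesicLine a b ∩ Metric.closedBall c r := by
        refine ⟨(hzero z).2 ?_, (mem_closedBall_iff_klein hr.le).2 ?_⟩
        · rw [hz1, hz2]; linear_combination δ * hcs
        · rw [hz1, hz2, hsq]
      rw [hp] at this
      rw [← Set.mem_singleton_iff.1 this]
      exact ⟨hz1, hz2⟩
    have h1 := hpt ε rfl
    have h2 := hpt (-ε) (by ring)
    have h3 : ε * Real.sin ψ = 0 := by linarith [h1.1, h2.1]
    have h4 : ε * Real.cos ψ = 0 := by linarith [h1.2, h2.2]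
    rw [(mul_eq_zero.1 h3).resolve_left hε.ne', (mul_eq_zero.1 h4).resolve_left hε.ne'] at hcs
    norm_num at hcs
  exact ⟨ψ, s, hs, by rwa [← hδρ]⟩

/-- In the Klein model centred at the centre of the inscribed circle, a tangential polygon is a
Euclidean polygon circumscribed about a circle centred at the origin. -/
lemma exists_isCircumscribed {P : Polygon ℍ n} {c : ℍ} {r : ℝ} (hP : IsConvexPolygon P)
    (hc : IsIncircle P c r) : ∃ φ : Fin n → ℝ,
      IsCircumscribed (Real.tanh r) φ (fun i ↦ kleinX c (P i)) (fun i ↦ kleinY c (P i)) ∧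
      region P = {z | ∀ i,
        Real.cos (φ i) * kleinX c z + Real.sin (φ i) * kleinY c z ≤ Real.tanh r} := by
  have hρ : 0 < Real.tanh r := tanh_pos hc.1
  choose φ s hs h using exists_side_eq hP hc
  choose t ht hst using h
  have hcr : c ∈ region P := hc.2.1 (Metric.mem_closedBall_self hc.1.le)
  have hprod : ∀ i z w, side (P i) (P (finRotate n i)) z * side (P i) (P (finRotate n i)) w =
      (t i z * t i w * s i ^ 2) *
        ((Real.tanh r - (Real.cos (φ i) * kleinX c z + Real.sin (φ i) * kleinY c z)) *
        (Real.tanh r - (Real.cos (φ i) * kleinX c w + Real.sin (φ i) * kleinY c w))) := by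
    intro i z w
    rw [hst, hst]; ring
  have hpos : ∀ i z w, 0 < t i z * t i w * s i ^ 2 := fun i z w ↦
    mul_pos (mul_pos (ht _ _) (ht _ _)) (sq_pos_of_ne_zero (hs i))
  -- The centre lies in the region, strictly on the inner side of every line, so it fixes the sign
  -- for all vertices.
  have hle : ∀ i j,
      Real.cos (φ i) * kleinX c (P j) + Real.sin (φ i) * kleinY c (P j) ≤ Real.tanh r := by
    intro i j
    have h1 := hcr i j
    rw [hprod, mul_nonneg_iff_of_pos_left (hpos _ _ _), (klein_self c).1, (klein_self c).2,
      mul_zero, mul_zero, add_zero, sub_zero, mul_nonneg_iff_of_pos_left hρ] at h1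
    linarith
  have heq : ∀ i j, side (P i) (P (finRotate n i)) (P j) = 0 →
      Real.cos (φ i) * kleinX c (P j) + Real.sin (φ i) * kleinY c (P j) = Real.tanh r := by
    intro i j h0
    rw [hst, mul_eq_zero, or_iff_right (mul_ne_zero (ht _ _).ne' (hs i))] at h0
    linarith
  have hlt : ∀ i j, j ≠ i → j ≠ finRotate n i →
      Real.cos (φ i) * kleinX c (P j) + Real.sin (φ i) * kleinY c (P j) < Real.tanh r := by
    intro i j h1 h2
    refine lt_of_le_of_ne (hle i j) fun h3 ↦ ?_
    have h4 := hP.2 i j j h1 h2 h1 h2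
    rw [hprod, h3] at h4
    simp at h4
  refine ⟨φ, ⟨hP.1, hρ, fun i ↦ klein_sq_lt_one _ _, fun i ↦ heq i _ (by simp [side]),
    fun i ↦ heq i _ (by simp only [side]; ring), hlt⟩, ?_⟩
  ext z
  refine ⟨fun hz i ↦ ?_, fun hz i j ↦ ?_⟩
  · obtain ⟨j, h1, h2⟩ := exists_ne_ne_finRotate hP.1 i
    have h3 := hz i j
    rw [hprod, mul_nonneg_iff_of_pos_left (hpos _ _ _),
      mul_nonneg_iff_of_pos_right (sub_pos.2 (hlt i j h1 h2))] at h3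
    linarith
  · rw [hprod]
    exact mul_nonneg (hpos _ _ _).le
      (mul_nonneg (sub_nonneg.2 (hz i)) (sub_nonneg.2 (hle i j)))

end

/-! ### Sides and tangent lengths of the circumscribed polygon -/

section

lemma finRotate_ne_self {n : ℕ} (hn : 2 ≤ n) (i : Fin n) : finRotate n i ≠ i := by
  obtain ⟨m, rfl⟩ := Nat.exists_eq_add_of_le' hn
  rw [finRotate_apply]
  simp

lemma finRotate_finRotate_ne_self {n : ℕ} (hn : 3 ≤ n) (i : Fin n) :
    finRotate n (finRotate n i) ≠ i := by
  obtain ⟨m, rfl⟩ := Nat.exists_eq_add_of_le' hn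
  rw [finRotate_apply, finRotate_apply, add_assoc]
  simp only [ne_eq, add_eq_left]
  rw [Fin.ext_iff]
  simp [Fin.val_add, Nat.mod_eq_of_lt]

/-- An affine function on the line, at most `ρ` at the ends of a segment, is at most `ρ` on it. -/
lemma affine_le_of_mem_segment {A B ρ L R τ : ℝ} (hL : A + B * L ≤ ρ) (hR : A + B * R ≤ ρ)
    (hne : L ≠ R) (h : (τ - L) * (τ - R) ≤ 0) : A + B * τ ≤ ρ := by
  have hD : 0 < (R - L) ^ 2 := by have := sub_ne_zero.2 hne.symm; positivity
  have h1 : 0 ≤ (R - τ) * (R - L) := by nlinarith [sq_nonneg (R - τ)]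
  have h2 : 0 ≤ (τ - L) * (R - L) := by nlinarith [sq_nonneg (τ - L)]
  have h3 : (R - L) ^ 2 * (A + B * τ) ≤ (R - L) ^ 2 * ρ := by
    nlinarith [mul_le_mul_of_nonneg_left hL h1, mul_le_mul_of_nonneg_left hR h2]
  exact le_of_mul_le_mul_left h3 hD

lemma mem_segment_of_affine_le {A B A' B' ρ L R τ : ℝ} (h1 : A + B * R = ρ) (h2 : A + B * L < ρ)
    (h3 : A' + B' * L = ρ) (h4 : A' + B' * R < ρ) (h5 : A + B * τ ≤ ρ) (h6 : A' + B' * τ ≤ ρ) :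
    (τ - L) * (τ - R) ≤ 0 := by
  have hB : 0 < (B * (R - L)) := by linarith
  have hB' : 0 < (B' * (L - R)) := by linarith
  have h7 : 0 ≤ B * (R - τ) := by linarith
  have h8 : 0 ≤ B' * (L - τ) := by linarith
  have h9 := mul_nonneg h7 h8
  have h10 : B * B' < 0 := by
    have := mul_pos hB hB'
    have h : (B * B') * (-(R - L) ^ 2) > 0 := by linarith
    nlinarith [sq_nonneg (R - L)]
  nlinarith

namespace IsCircumscribed

variable {n : ℕ} {ρ : ℝ} {φ x y : Fin n → ℝ}

/-- The position of vertex `i` on the line carrying side `i`, relative to the point of tangency. -/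
def tanLeft (φ x y : Fin n → ℝ) (i : Fin n) : ℝ := Real.cos (φ i) * y i - Real.sin (φ i) * x i

/-- The position of the vertex after `i` on the line carrying side `i`, relative to the point of
tangency. -/
def tanRight (φ x y : Fin n → ℝ) (i : Fin n) : ℝ :=
  Real.cos (φ i) * y (finRotate n i) - Real.sin (φ i) * x (finRotate n i)

variable (h : IsCircumscribed ρ φ x y)

include h

lemma left_eq (i : Fin n) :
    x i = ρ * Real.cos (φ i) - tanLeft φ x y i * Real.sin (φ i) ∧
    y i = ρ * Real.sin (φ i) + tanLeft φ x y i * Real.cos (φ i) := by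
  have h1 := h.eq_left i
  have h2 := Real.cos_sq_add_sin_sq (φ i)
  unfold tanLeft
  constructor
  · linear_combination Real.cos (φ i) * h1 - x i * h2
  · linear_combination Real.sin (φ i) * h1 - y i * h2

lemma right_eq (i : Fin n) :
    x (finRotate n i) = ρ * Real.cos (φ i) - tanRight φ x y i * Real.sin (φ i) ∧
    y (finRotate n i) = ρ * Real.sin (φ i) + tanRight φ x y i * Real.cos (φ i) := by
  have h1 := h.eq_right i
  have h2 := Real.cos_sq_add_sin_sq (φ i)
  unfold tanRight
  constructor
  · linear_combination Real.cos (φ i) * h1 - x (finRotate n i) * h2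
  · linear_combination Real.sin (φ i) * h1 - y (finRotate n i) * h2

lemma sq_add_sq_left (i : Fin n) : x i ^ 2 + y i ^ 2 = ρ ^ 2 + tanLeft φ x y i ^ 2 := by
  obtain ⟨h1, h2⟩ := h.left_eq i
  have h3 := Real.cos_sq_add_sin_sq (φ i)
  rw [h1, h2]
  linear_combination (ρ ^ 2 + tanLeft φ x y i ^ 2) * h3

lemma sq_add_sq_right (i : Fin n) :
    x (finRotate n i) ^ 2 + y (finRotate n i) ^ 2 = ρ ^ 2 + tanRight φ x y i ^ 2 := by
  obtain ⟨h1, h2⟩ := h.right_eq i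
  have h3 := Real.cos_sq_add_sin_sq (φ i)
  rw [h1, h2]
  linear_combination (ρ ^ 2 + tanRight φ x y i ^ 2) * h3

lemma tanRight_sq (i : Fin n) : tanRight φ x y i ^ 2 = tanLeft φ x y (finRotate n i) ^ 2 := by
  linarith [h.sq_add_sq_left (finRotate n i), h.sq_add_sq_right i]

lemma le (i j : Fin n) : Real.cos (φ i) * x j + Real.sin (φ i) * y j ≤ ρ := by
  by_cases h1 : j = i
  · exact h1 ▸ (h.eq_left j).le
  by_cases h2 : j = finRotate n i
  · exact h2 ▸ (h.eq_right i).le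
  exact (h.lt_of_ne i j h1 h2).le

/-- The point at position `τ` on line `i` has value `ρ * cos (φ i - φ j) + sin (φ j - φ i) * τ`
under the linear form of side `j`; here `τ = tanLeft φ x y i`. -/
lemma left_value (i j : Fin n) : ρ * Real.cos (φ i - φ j) +
    Real.sin (φ j - φ i) * tanLeft φ x y i = Real.cos (φ j) * x i + Real.sin (φ j) * y i := by
  obtain ⟨h1, h2⟩ := h.left_eq i
  rw [h1, h2, Real.cos_sub, Real.sin_sub]
  ring

lemma right_value (i j : Fin n) : ρ * Real.cos (φ i - φ j) +
    Real.sin (φ j - φ i) * tanRight φ x y i =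
      Real.cos (φ j) * x (finRotate n i) + Real.sin (φ j) * y (finRotate n i) := by
  obtain ⟨h1, h2⟩ := h.right_eq i
  rw [h1, h2, Real.cos_sub, Real.sin_sub]
  ring

lemma value_next_left_lt (i : Fin n) : ρ * Real.cos (φ i - φ (finRotate n i)) +
    Real.sin (φ (finRotate n i) - φ i) * tanLeft φ x y i < ρ := by
  rw [h.left_value]
  exact h.lt_of_ne _ _ (finRotate_ne_self (by linarith [h.three_le]) i).symm
    (finRotate_finRotate_ne_self h.three_le i).symm

lemma value_prev_right_lt (i : Fin n) : ρ * Real.cos (φ (finRotate n i) - φ i) +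
    Real.sin (φ i - φ (finRotate n i)) * tanRight φ x y (finRotate n i) < ρ := by
  rw [h.right_value]
  exact h.lt_of_ne _ _ (finRotate_finRotate_ne_self h.three_le i)
    ((finRotate n).injective.ne (finRotate_ne_self (by linarith [h.three_le]) i))

/-- The side `i` is the part of its line that lies in the polygon. -/
lemma forall_le_iff (i : Fin n) (τ : ℝ) :
    (∀ j, ρ * Real.cos (φ i - φ j) + Real.sin (φ j - φ i) * τ ≤ ρ) ↔
      (τ - tanLeft φ x y i) * (τ - tanRight φ x y i) ≤ 0 := by
  have hne : tanLeft φ x y i ≠ tanRight φ x y i := by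
    intro h0
    have h1 := h.value_next_left_lt i
    rw [h0, h.right_value, h.eq_left] at h1
    exact h1.false
  obtain ⟨m, rfl⟩ := (finRotate n).surjective i
  refine ⟨fun h1 ↦ ?_, fun h1 j ↦ ?_⟩
  -- The constraints of the two neighbouring sides already confine `τ` to the side.
  · exact mem_segment_of_affine_le ((h.right_value _ _).trans (h.eq_left _))
      (h.value_next_left_lt _) ((h.left_value _ _).trans (h.eq_right _)) (h.value_prev_right_lt _)
      (h1 _) (h1 _)
  · refine affine_le_of_mem_segment ?_ ?_ hne h1
    · rw [h.left_value]; exact h.le _ _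
    · rw [h.right_value]; exact h.le _ _

/-- A vertex at the point of tangency would lie on the circle, where only one tangent passes, so two
consecutive sides would share their line. -/
lemma tanLeft_ne_zero (i : Fin n) : tanLeft φ x y i ≠ 0 := by
  obtain ⟨m, rfl⟩ := (finRotate n).surjective i
  intro h0
  have h1 := (h.left_value (finRotate n m) m).trans (h.eq_right m)
  have h2 := h.value_prev_right_lt m
  have h3 := h.pos
  rw [h0, mul_zero, add_zero, mul_eq_left₀ h3.ne'] at h1
  have h4 : Real.sin (φ (finRotate n m) - φ m) = 0 := Real.sin_eq_zero_iff_cos_eq.2 (Or.inl h1)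
  rw [← neg_sub (φ (finRotate n m)), Real.sin_neg, h4, h1] at h2
  simp at h2

lemma tanRight_ne_zero (i : Fin n) : tanRight φ x y i ≠ 0 := by
  have h1 := h.tanLeft_ne_zero (finRotate n i)
  rw [← sq_pos_iff, h.tanRight_sq]
  positivity

/-- The point of tangency (`τ = 0`) satisfies every side inequality, because `cos ≤ 1`; it is
therefore on the side, and it is neither end. -/
lemma tanLeft_mul_tanRight_neg (i : Fin n) : tanLeft φ x y i * tanRight φ x y i < 0 := by
  have h1 := (h.forall_le_iff i 0).1 fun j ↦ by
    nlinarith [Real.cos_le_one (φ i - φ j), h.pos]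
  refine lt_of_le_of_ne (by linarith) (mul_ne_zero (h.tanLeft_ne_zero i) (h.tanRight_ne_zero i))

/-- Every direction makes an acute angle with the outer normal of some side. -/
lemma exists_cos_pos (ψ : ℝ) : ∃ i, 0 < Real.cos (ψ - φ i) := by
  have : Nonempty (Fin n) := ⟨⟨0, by linarith [h.three_le]⟩⟩
  -- At a vertex that is extreme in direction `ψ`, this direction lies in the cone spanned by the
  -- normals of the two adjacent sides, so it cannot have nonpositive product with both.
  obtain ⟨i, hi⟩ := Finite.exists_max fun i ↦ Real.cos ψ * x i + Real.sin ψ * y i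
  obtain ⟨m, rfl⟩ := (finRotate n).surjective i
  by_contra! hneg
  have h1 := hi m
  have h2 := hi (finRotate n (finRotate n m))
  obtain ⟨e1, e2⟩ := h.left_eq m
  obtain ⟨e3, e4⟩ := h.right_eq m
  obtain ⟨e5, e6⟩ := h.left_eq (finRotate n m)
  obtain ⟨e7, e8⟩ := h.right_eq (finRotate n m)
  have h3 := h.value_next_left_lt m
  have h4 := (h.right_value m (finRotate n m)).trans (h.eq_left _)
  have h5 := (h.left_value (finRotate n m) m).trans (h.eq_right m)
  have h6 := h.value_prev_right_lt m
  have h7 := hneg m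
  have h8 := hneg (finRotate n m)
  have g1 : (tanLeft φ x y m - tanRight φ x y m) * Real.sin (ψ - φ m) ≤ 0 := by
    rw [e1, e2, e3, e4] at h1
    rw [Real.sin_sub]
    linarith
  have g2 : (tanRight φ x y (finRotate n m) - tanLeft φ x y (finRotate n m)) *
      Real.sin (ψ - φ (finRotate n m)) ≤ 0 := by
    rw [e5, e6, e7, e8] at h2
    rw [Real.sin_sub]
    linarith
  have hw : Real.sin (φ (finRotate n m) - φ m) =
      Real.sin (ψ - φ m) * Real.cos (ψ - φ (finRotate n m)) -
      Real.cos (ψ - φ m) * Real.sin (ψ - φ (finRotate n m)) := by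
    rw [← Real.sin_sub]; ring_nf
  have h9 : Real.sin (φ m - φ (finRotate n m)) = -Real.sin (φ (finRotate n m) - φ m) := by
    rw [← Real.sin_neg, neg_sub]
  rw [h9] at h5 h6
  set w := Real.sin (φ (finRotate n m) - φ m)
  set D := tanRight φ x y m - tanLeft φ x y m with hD
  set D' := tanRight φ x y (finRotate n m) - tanLeft φ x y (finRotate n m) with hD'
  have k1 : 0 < w * D := by linarith
  have k2 : 0 < w * D' := by linarith
  have k3 : 0 ≤ w * Real.sin (ψ - φ m) := by
    by_contra! hlt
    have := mul_pos_of_neg_of_neg hlt (neg_neg_of_pos k1)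
    nlinarith [sq_nonneg w]
  have k4 : w * Real.sin (ψ - φ (finRotate n m)) ≤ 0 := by
    by_contra! hlt
    have := mul_pos hlt k2
    nlinarith [sq_nonneg w]
  have k5 : 0 < w ^ 2 := by
    have : w ≠ 0 := by rintro h0; rw [h0] at k1; simp at k1
    positivity
  have k6 : w ^ 2 = w * Real.sin (ψ - φ m) * Real.cos (ψ - φ (finRotate n m)) -
      w * Real.sin (ψ - φ (finRotate n m)) * Real.cos (ψ - φ m) := by linear_combination w * hw
  linarith [mul_nonneg_of_nonpos_of_nonpos k4 h7, mul_nonneg k3 (neg_nonneg.2 h8)]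

lemma cos_pos_of_forall_le {i : Fin n} {t : ℝ}
    (ht : ∀ j, Real.cos (φ i + t - φ j) ≤ Real.cos t) : 0 < Real.cos t :=
  let ⟨j, hj⟩ := h.exists_cos_pos (φ i + t)
  hj.trans_le (ht j)

/-- The ray in direction `φ i + t` meets line `i` at position `ρ * tan t`. Side `i` is met first
exactly when this point satisfies the other constraints, that is, lies on the side. -/
lemma forall_cos_le_iff (i : Fin n) (t : ℝ) :
    (∀ j, Real.cos (φ i + t - φ j) ≤ Real.cos t) ↔ 0 < Real.cos t ∧
      (ρ * Real.tan t - tanLeft φ x y i) * (ρ * Real.tan t - tanRight φ x y i) ≤ 0 := by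
  rw [← h.forall_le_iff]
  have key : 0 < Real.cos t → ((∀ j, Real.cos (φ i + t - φ j) ≤ Real.cos t) ↔
      ∀ j, ρ * Real.cos (φ i - φ j) + Real.sin (φ j - φ i) * (ρ * Real.tan t) ≤ ρ) := by
    intro hpos
    refine forall_congr' fun j ↦ ?_
    have : Real.cos t * (ρ * Real.cos (φ i - φ j) + Real.sin (φ j - φ i) * (ρ * Real.tan t)) =
        ρ * Real.cos (φ i + t - φ j) := by
      rw [Real.tan_eq_sin_div_cos, show φ i + t - φ j = (φ i - φ j) + t by ring, Real.cos_add,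
        ← neg_sub (φ i) (φ j), Real.sin_neg]
      field_simp
      ring
    rw [← mul_le_mul_iff_right₀ (b := ρ * Real.cos (φ i - φ j) + _) hpos, this,
      mul_comm (Real.cos t) ρ, mul_le_mul_iff_right₀ h.pos]
  exact ⟨fun h1 ↦ ⟨h.cos_pos_of_forall_le h1, (key (h.cos_pos_of_forall_le h1)).1 h1⟩,
    fun h1 ↦ (key h1.1).2 h1.2⟩

end IsCircumscribed

end

/-! ### Integration over directions, split into sectors -/

section

open Real Set in
lemma arc_eq_Icc {ρ L R : ℝ} (hρ : 0 < ρ) (hLR : L < R) :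
    {t | 0 < cos t ∧ (ρ * tan t - L) * (ρ * tan t - R) ≤ 0} ∩ Ioc (-π) π =
      Icc (arctan (L / ρ)) (arctan (R / ρ)) := by
  have hseg : ∀ τ, (τ - L) * (τ - R) ≤ 0 ↔ L ≤ τ ∧ τ ≤ R := by
    intro τ
    rw [mul_nonpos_iff]
    constructor
    · rintro (h | h) <;> constructor <;> linarith [h.1, h.2]
    · rintro h; left; constructor <;> linarith [h.1, h.2]
  have hmem : ∀ t, t ∈ Ioo (-(π / 2)) (π / 2) →
      ((ρ * tan t - L) * (ρ * tan t - R) ≤ 0 ↔ arctan (L / ρ) ≤ t ∧ t ≤ arctan (R / ρ)) := by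
    intro t ht
    rw [hseg, mul_comm, ← div_le_iff₀ hρ, ← le_div_iff₀ hρ,
      ← arctan_le_arctan_iff (x := L / ρ), ← arctan_le_arctan_iff (x := tan t),
      arctan_tan ht.1 ht.2]
  ext t
  constructor
  · rintro ⟨⟨h1, h2⟩, h3, h4⟩
    refine (hmem t ⟨?_, ?_⟩).1 h2
    · by_contra! h
      have := cos_nonpos_of_pi_div_two_le_of_le (x := -t) (by linarith) (by linarith)
      rw [cos_neg] at this
      linarith
    · by_contra! h
      have := cos_nonpos_of_pi_div_two_le_of_le (x := t) (by linarith) (by linarith)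
      linarith
  · rintro ⟨h1, h2⟩
    have h3 := neg_pi_div_two_lt_arctan (L / ρ)
    have h4 := arctan_lt_pi_div_two (R / ρ)
    have h5 : t ∈ Ioo (-(π / 2)) (π / 2) := ⟨by linarith, by linarith⟩
    exact ⟨⟨cos_pos_of_mem_Ioo h5, (hmem t h5).2 ⟨h1, h2⟩⟩, by linarith [h5.1, pi_pos],
      by linarith [h5.2, pi_pos]⟩

open Set in
lemma setLIntegral_Icc_of_even {G : ℝ → ENNReal} (hG : ∀ t, G (-t) = G t) {a b : ℝ} (ha : 0 ≤ a)
    (hb : 0 ≤ b) :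
    ∫⁻ t in Icc (-a) b, G t = (∫⁻ t in Icc 0 a, G t) + ∫⁻ t in Icc 0 b, G t := by
  have hu : Icc (-a) b = Ico (-a) 0 ∪ Icc 0 b := (Ico_union_Icc_eq_Icc (by linarith) hb).symm
  have hd : Disjoint (Ico (-a) 0) (Icc 0 b) :=
    Set.disjoint_left.2 fun t h1 h2 ↦ h1.2.not_ge h2.1
  rw [hu, lintegral_union measurableSet_Icc hd]
  congr 1
  rw [← (Measure.measurePreserving_neg (volume : Measure ℝ)).setLIntegral_comp_preimage_emb
    (MeasurableEquiv.neg ℝ).measurableEmbedding]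
  simp only [hG, Set.neg_preimage, Set.neg_Ico, neg_zero, neg_neg]
  exact setLIntegral_congr Ioc_ae_eq_Icc

open Set in
lemma setLIntegral_Ioc_comp_add {T : ℝ} (hT : 0 < T) {H : ℝ → ENNReal} (hH : Function.Periodic H T)
    (a s : ℝ) : ∫⁻ t in Ioc a (a + T), H t = ∫⁻ t in Ioc a (a + T), H (s + t) := by
  have h1 : ∫⁻ t in Ioc a (a + T), H t = ∫⁻ t in Ioc (s + a) (s + a + T), H t := by
    refine (isAddFundamentalDomain_Ioc hT a).setLIntegral_eq (isAddFundamentalDomain_Ioc hT (s + a))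
      H fun g t ↦ ?_
    obtain ⟨k, hk⟩ := AddSubgroup.mem_zmultiples_iff.1 g.2
    rw [AddSubgroup.vadd_def, ← hk, vadd_eq_add, add_comm]
    exact hH.zsmul k t
  rw [h1, ← (measurePreserving_add_left (volume : Measure ℝ) s).setLIntegral_comp_preimage_emb
    (MeasurableEquiv.addLeft s).measurableEmbedding]
  simp [add_assoc]

namespace IsCircumscribed

variable {n : ℕ} {ρ : ℝ} {φ x y : Fin n → ℝ}

/-- Half the angle that the two tangents from vertex `i` cut out at the centre. -/
def halfAngle (ρ : ℝ) (φ x y : Fin n → ℝ) (i : Fin n) : ℝ := Real.arctan (|tanLeft φ x y i| / ρ)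

lemma halfAngle_lt (i : Fin n) : halfAngle ρ φ x y i < Real.pi / 2 := Real.arctan_lt_pi_div_two _

lemma cos_halfAngle_pos (i : Fin n) : 0 < Real.cos (halfAngle ρ φ x y i) :=
  Real.cos_arctan_pos _

variable (h : IsCircumscribed ρ φ x y)

include h

/-- The two tangents from a vertex have equal length, so the half-angle is the same seen from either
adjacent side. -/
lemma halfAngle_finRotate (i : Fin n) :
    halfAngle ρ φ x y (finRotate n i) = Real.arctan (|tanRight φ x y i| / ρ) := by
  rw [halfAngle, (sq_eq_sq_iff_abs_eq_abs _ _).1 (h.tanRight_sq i)]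

lemma halfAngle_pos (i : Fin n) : 0 < halfAngle ρ φ x y i :=
  Real.arctan_pos.2 (div_pos (abs_pos.2 (h.tanLeft_ne_zero i)) h.pos)

lemma tan_halfAngle (i : Fin n) : ρ * Real.tan (halfAngle ρ φ x y i) = |tanLeft φ x y i| := by
  have := h.pos
  rw [halfAngle, Real.tan_arctan]
  field_simp

lemma cos_halfAngle_sq (i : Fin n) :
    (x i ^ 2 + y i ^ 2) * Real.cos (halfAngle ρ φ x y i) ^ 2 = ρ ^ 2 := by
  have h1 := h.tan_halfAngle i
  have h2 := cos_halfAngle_pos (ρ := ρ) (φ := φ) (x := x) (y := y) i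
  have h3 := Real.cos_sq_add_sin_sq (halfAngle ρ φ x y i)
  rw [h.sq_add_sq_left, ← sq_abs (tanLeft φ x y i), ← h1, Real.tan_eq_sin_div_cos]
  field_simp
  linear_combination ρ ^ 2 * h3

/-- The vertex is at Euclidean distance `ρ / cos θ` from the origin, and it lies in the open unit
disc. -/
lemma lt_cos_halfAngle (i : Fin n) : ρ < Real.cos (halfAngle ρ φ x y i) := by
  have h1 := h.cos_halfAngle_sq i
  have h2 := cos_halfAngle_pos (ρ := ρ) (φ := φ) (x := x) (y := y) i
  refine lt_of_pow_lt_pow_left₀ 2 h2.le ?_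
  rw [← h1]
  exact mul_lt_of_lt_one_left (by positivity) (h.sq_lt_one i)

/-- The directions for which the line carrying side `i` is the first one to be met. -/
def sector (φ : Fin n → ℝ) (i : Fin n) : Set ℝ :=
  {ψ | ∀ j, Real.cos (ψ - φ j) ≤ Real.cos (ψ - φ i)}

open Set Real in
lemma setLIntegral_sector (i : Fin n) (g : ℝ → ENNReal) :
    ∫⁻ t in {t | φ i + t ∈ sector φ i} ∩ Ioc (-π) π, g (cos t) =
      (∫⁻ t in Icc 0 (halfAngle ρ φ x y i), g (cos t)) +
        ∫⁻ t in Icc 0 (halfAngle ρ φ x y (finRotate n i)), g (cos t) := by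
  have hs : {t | φ i + t ∈ sector φ i} = {t | 0 < cos t ∧
      (ρ * tan t - tanLeft φ x y i) * (ρ * tan t - tanRight φ x y i) ≤ 0} := by
    ext t
    rw [mem_ofPred_eq, mem_ofPred_eq, ← h.forall_cos_le_iff, sector, mem_ofPred_eq,
      add_sub_cancel_left]
  have hρ := h.pos
  rw [hs, h.halfAngle_finRotate, halfAngle]
  -- The two cases are the two orientations; evenness of `cos` makes them agree.
  rcases mul_neg_iff.1 (h.tanLeft_mul_tanRight_neg i) with ⟨h1, h2⟩ | ⟨h1, h2⟩
  · simp_rw [mul_comm (ρ * tan _ - tanLeft φ x y i)]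
    rw [arc_eq_Icc hρ (h2.trans h1), abs_of_neg h2, abs_of_pos h1, add_comm,
      ← setLIntegral_Icc_of_even (G := fun t ↦ g (cos t)) (fun t ↦ by rw [cos_neg])
      (arctan_nonneg.2 (div_nonneg (neg_pos.2 h2).le hρ.le))
      (arctan_nonneg.2 (div_nonneg h1.le hρ.le)), neg_div, arctan_neg, neg_neg]
  · rw [arc_eq_Icc hρ (h1.trans h2), abs_of_neg h1, abs_of_pos h2,
      ← setLIntegral_Icc_of_even (G := fun t ↦ g (cos t)) (fun t ↦ by rw [cos_neg])
      (arctan_nonneg.2 (div_nonneg (neg_pos.2 h1).le hρ.le))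
      (arctan_nonneg.2 (div_nonneg h2.le hρ.le)), neg_div, arctan_neg, neg_neg]

/-- With equal normals both ends of side `i` would lie on line `j`, which contains no vertices but
the two ends of side `j`. -/
lemma normal_ne {i j : Fin n} (hij : i ≠ j) (k : ℤ) : φ i ≠ φ j + k * (2 * Real.pi) := by
  intro h0
  have hc : Real.cos (φ i) = Real.cos (φ j) := by rw [h0, Real.cos_add_int_mul_two_pi]
  have hs : Real.sin (φ i) = Real.sin (φ j) := by rw [h0, Real.sin_add_int_mul_two_pi]
  have h1 := h.eq_left i
  have h2 := h.eq_right i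
  rw [hc, hs] at h1 h2
  by_cases h3 : i = finRotate n j
  · refine (h.lt_of_ne j (finRotate n i) ?_ ?_).ne h2
    · rw [h3]; exact finRotate_finRotate_ne_self h.three_le j
    · exact fun h4 ↦ hij ((finRotate n).injective h4)
  · exact (h.lt_of_ne j i hij h3).ne h1

lemma volume_sector_inter {i j : Fin n} (hij : i ≠ j) :
    volume (sector φ i ∩ sector φ j) = 0 := by
  refine Set.Countable.measure_zero (Set.Countable.mono ?_
    (Set.countable_range fun k : ℤ ↦ k * Real.pi + (φ i + φ j) / 2)) _
  rintro ψ ⟨h1, h2⟩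
  obtain ⟨k, hk | hk⟩ := Real.cos_eq_cos_iff.1 (le_antisymm (h2 i) (h1 j))
  · refine absurd ?_ (h.normal_ne hij k)
    linarith
  · refine ⟨k, ?_⟩
    simp only
    linarith

open Set Real in
/-- The integral over all directions, decomposed according to the side that is met first. -/
lemma setLIntegral_eq_sum {F g : ℝ → ENNReal} (hF : Function.Periodic F (2 * π))
    (hFg : ∀ i t, φ i + t ∈ sector φ i → F (φ i + t) = g (cos t)) :
    ∫⁻ ψ in Ioc (-π) π, F ψ = 2 * ∑ i, ∫⁻ t in Icc 0 (halfAngle ρ φ x y i), g (cos t) := by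
  have : Nonempty (Fin n) := ⟨⟨0, by linarith [h.three_le]⟩⟩
  have hmeas : ∀ i, MeasurableSet (sector φ i) := by
    intro i
    refine IsClosed.measurableSet ?_
    simp only [sector, ofPred_forall]
    exact isClosed_iInter fun j ↦ isClosed_le (by fun_prop) (by fun_prop)
  have hU : ⋃ i, sector φ i = univ := by
    refine eq_univ_of_forall fun ψ ↦ ?_
    obtain ⟨i, hi⟩ := Finite.exists_max fun i ↦ cos (ψ - φ i)
    exact mem_iUnion.2 ⟨i, hi⟩
  have hpi : (π : ℝ) = -π + 2 * π := by ring
  have h1 : ∫⁻ ψ in Ioc (-π) π, F ψ =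
      ∑' i, ∫⁻ ψ in sector φ i, F ψ ∂(volume.restrict (Ioc (-π) π)) := by
    rw [← lintegral_iUnion₀ (fun i ↦ (hmeas i).nullMeasurableSet), hU, Measure.restrict_univ]
    intro i j hij
    exact Measure.absolutelyContinuous_restrict (h.volume_sector_inter hij)
  have h2 : ∀ i, ∫⁻ ψ in sector φ i, F ψ ∂(volume.restrict (Ioc (-π) π)) =
      (∫⁻ t in Icc 0 (halfAngle ρ φ x y i), g (cos t)) +
        ∫⁻ t in Icc 0 (halfAngle ρ φ x y (finRotate n i)), g (cos t) := by
    intro i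
    have hm : MeasurableSet {t | φ i + t ∈ sector φ i} :=
      (measurable_const_add (φ i)) (hmeas i)
    have hper : Function.Periodic ((sector φ i).indicator F) (2 * π) := by
      intro ψ
      have : ψ + 2 * π ∈ sector φ i ↔ ψ ∈ sector φ i := by
        simp [sector, add_sub_right_comm]
      by_cases hψ : ψ ∈ sector φ i
      · rw [indicator_of_mem hψ, indicator_of_mem (this.2 hψ), hF]
      · rw [indicator_of_notMem hψ, indicator_of_notMem (mt this.1 hψ)]
    rw [← h.setLIntegral_sector, ← lintegral_indicator (hmeas i),
      ← Measure.restrict_restrict hm, ← lintegral_indicator hm]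
    have hshift := setLIntegral_Ioc_comp_add two_pi_pos hper (-π) (φ i)
    rw [← hpi] at hshift
    rw [hshift]
    refine lintegral_congr fun t ↦ ?_
    by_cases ht : φ i + t ∈ sector φ i
    · rw [indicator_of_mem ht, indicator_of_mem (by exact ht), hFg i t ht]
    · rw [indicator_of_notMem ht, indicator_of_notMem (by exact ht)]
  -- Each vertex contributes to its two adjacent sides, hence the factor `2`.
  rw [h1, tsum_fintype, Finset.sum_congr rfl fun i _ ↦ h2 i, Finset.sum_add_distrib,
    Equiv.sum_comp (finRotate n) fun i ↦ ∫⁻ t in Icc 0 (halfAngle ρ φ x y i), g (cos t), two_mul]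

/-- The decomposition applied to the constant `1`: the sectors fill the full angle `2π`. -/
lemma sum_halfAngle : ∑ i, halfAngle ρ φ x y i = Real.pi := by
  have h1 := h.setLIntegral_eq_sum (F := fun _ ↦ 1) (g := fun _ ↦ 1) (fun _ ↦ rfl) fun _ _ _ ↦ rfl
  simp only [setLIntegral_one, Real.volume_Ioc, Real.volume_Icc, sub_zero] at h1
  rw [← ENNReal.ofReal_sum_of_nonneg fun i _ ↦ (h.halfAngle_pos i).le,
    ← ENNReal.ofReal_ofNat 2, ← ENNReal.ofReal_mul (by norm_num),
    ENNReal.ofReal_eq_ofReal_iff (by linarith [Real.pi_pos])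
      (mul_nonneg (by norm_num) (Finset.sum_nonneg fun i _ ↦ (h.halfAngle_pos i).le))] at h1
  linarith

end IsCircumscribed

end

section

/-! ### Polar coordinates and the area -/

lemma det_eq_of_real_prod (L : ℝ × ℝ →L[ℝ] ℝ × ℝ) :
    L.det = (L (1, 0)).1 * (L (0, 1)).2 - (L (0, 1)).1 * (L (1, 0)).2 := by
  rw [ContinuousLinearMap.det, ← LinearMap.det_toMatrix (Module.Basis.finTwoProd ℝ),
    Matrix.det_fin_two]
  simp [LinearMap.toMatrix_apply]

/-- The point at distance `arcosh t` from `c` in direction `ψ`, as a pair of real coordinates. -/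
def polar (c : ℍ) (p : ℝ × ℝ) : ℝ × ℝ :=
  (c.re + c.im * (p.1 - √(p.1 ^ 2 - 1) * Real.sin p.2)⁻¹ * √(p.1 ^ 2 - 1) * Real.cos p.2,
    c.im * (p.1 - √(p.1 ^ 2 - 1) * Real.sin p.2)⁻¹)

lemma polar_den_pos {t : ℝ} (ht : 1 < t) (ψ : ℝ) : 0 < t - √(t ^ 2 - 1) * Real.sin ψ := by
  have h1 : √(t ^ 2 - 1) < t := by
    rw [Real.sqrt_lt' (by linarith)]; linarith
  nlinarith [Real.sin_le_one ψ, Real.sqrt_nonneg (t ^ 2 - 1)]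

lemma polar_snd_pos (c : ℍ) {p : ℝ × ℝ} (hp : 1 < p.1) : 0 < (polar c p).2 :=
  mul_pos c.im_pos (inv_pos.2 (polar_den_pos hp p.2))

/-- With `t = cosh d` as radial variable, `sinh d` times the differential of `d` is that of `t`.
Thus hyperbolic area becomes Lebesgue measure in `(t, ψ)`: the Jacobian `y ^ 2` cancels the density
`1 / y ^ 2`. -/
lemma exists_hasFDerivAt_polar (c : ℍ) {p : ℝ × ℝ} (hp : 1 < p.1) :
    ∃ L : ℝ × ℝ →L[ℝ] ℝ × ℝ, HasFDerivAt (polar c) L p ∧ L.det = (polar c p).2 ^ 2 := by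
  have hD := polar_den_pos hp p.2
  have hsq : 0 < p.1 ^ 2 - 1 := by nlinarith
  have hw : HasFDerivAt (fun p : ℝ × ℝ ↦ √(p.1 ^ 2 - 1))
      ((p.1 / √(p.1 ^ 2 - 1)) • ContinuousLinearMap.fst ℝ ℝ ℝ) p := by
    have h1 : HasDerivAt (fun t : ℝ ↦ √(t ^ 2 - 1)) (p.1 / √(p.1 ^ 2 - 1)) p.1 := by
      convert ((hasDerivAt_pow 2 p.1).sub_const 1).sqrt hsq.ne' using 1
      field_simp
      simp [mul_comm]
    exact h1.comp_hasFDerivAt p hasFDerivAt_fst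
  have hs := (Real.hasDerivAt_sin p.2).comp_hasFDerivAt p (hasFDerivAt_snd (𝕜 := ℝ) (p := p))
  have hc := (Real.hasDerivAt_cos p.2).comp_hasFDerivAt p (hasFDerivAt_snd (𝕜 := ℝ) (p := p))
  have hden := (hasFDerivAt_fst (𝕜 := ℝ) (p := p)).sub (hw.mul hs)
  have hy := ((hasDerivAt_inv hD.ne').comp_hasFDerivAt p hden).const_mul c.im
  have hx := ((hy.mul hw).mul hc).const_add c.re
  refine ⟨_, hx.prodMk hy, ?_⟩
  rw [det_eq_of_real_prod]
  simp only [polar]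
  have hwpos : 0 < √(p.1 ^ 2 - 1) := Real.sqrt_pos.2 hsq
  have hcs := Real.cos_sq_add_sin_sq p.2
  simp
  generalize √(p.1 ^ 2 - 1) = w at *
  generalize Real.sin p.2 = s at *
  generalize Real.cos p.2 = k at *
  clear hx hy hden hc hs hw
  generalize p.1 = t at *
  field_simp
  linear_combination t * (t - w * s) * hcs

lemma klein_of_polar {c z : ℍ} {p : ℝ × ℝ} (hp : 1 < p.1) (hx : z.re = (polar c p).1)
    (hy : z.im = (polar c p).2) :
    kleinX c z = √(p.1 ^ 2 - 1) / p.1 * Real.cos p.2 ∧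
    kleinY c z = √(p.1 ^ 2 - 1) / p.1 * Real.sin p.2 := by
  have hD := polar_den_pos hp p.2
  have hb := c.im_pos
  have ht : 0 < p.1 := by linarith
  have hw : √(p.1 ^ 2 - 1) ^ 2 = p.1 ^ 2 - 1 := Real.sq_sqrt (by nlinarith)
  have hcs := Real.cos_sq_add_sin_sq p.2
  have hN : kleinDen c z = 2 * p.1 * c.im ^ 2 * (p.1 - √(p.1 ^ 2 - 1) * Real.sin p.2)⁻¹ := by
    rw [kleinDen, hx, hy, polar]
    field_simp
    linear_combination c.im ^ 2 * √(p.1 ^ 2 - 1) ^ 2 * hcs + c.im ^ 2 * hw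
  have hN2 : (z.re - c.re) ^ 2 + z.im ^ 2 - c.im ^ 2 = kleinDen c z - 2 * c.im ^ 2 := by
    rw [kleinDen]; ring
  rw [kleinX, kleinY, hN2, hN, hx, polar]
  constructor
  · field_simp
    ring
  · field_simp
    ring

open Set Real

lemma exists_polar_eq {c z : ℍ} (hz : z ≠ c) :
    ∃ p ∈ Ioi (1 : ℝ) ×ˢ Ioc (-π) π, (polar c p).1 = z.re ∧ (polar c p).2 = z.im := by
  have ht : 1 < cosh (dist c z) := one_lt_cosh.2 (dist_pos.2 hz.symm).ne'
  set t := cosh (dist c z) with ht_def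
  set k : ℂ := ⟨kleinX c z, kleinY c z⟩ with hk_def
  have hk : ‖k‖ = √(t ^ 2 - 1) / t := by
    rw [← sq_eq_sq₀ (norm_nonneg _) (by positivity), ← Complex.normSq_eq_norm_sq,
      Complex.normSq_apply, div_pow, Real.sq_sqrt (by nlinarith), ← sq, ← sq, klein_sq, ← ht_def]
    field_simp
  have hp : 1 < (t, Complex.arg k).1 := ht
  have hpos := polar_snd_pos c hp
  let z' : ℍ := ⟨⟨(polar c (t, Complex.arg k)).1, (polar c (t, Complex.arg k)).2⟩, hpos⟩
  have hz' := klein_of_polar (z := z') hp rfl rfl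
  simp only [← hk, Complex.norm_mul_cos_arg, Complex.norm_mul_sin_arg] at hz'
  have heq : z' = z := klein_injective hz'.1 hz'.2
  refine ⟨(t, Complex.arg k), ⟨ht, Complex.arg_mem_Ioc k⟩, ?_, ?_⟩
  · rw [← heq]; rfl
  · rw [← heq]; rfl

lemma polar_injOn (c : ℍ) : InjOn (polar c) (Ioi (1 : ℝ) ×ˢ Ioc (-π) π) := by
  rintro ⟨t, ψ⟩ ⟨ht, hψ⟩ ⟨t', ψ'⟩ ⟨ht', hψ'⟩ heq
  simp only [mem_Ioi] at ht ht' hψ hψ'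
  let z : ℍ := ⟨⟨(polar c (t, ψ)).1, (polar c (t, ψ)).2⟩, polar_snd_pos c (p := (t, ψ)) ht⟩
  obtain ⟨h1, h2⟩ := klein_of_polar (c := c) (z := z) (p := (t, ψ)) ht rfl rfl
  obtain ⟨h3, h4⟩ := klein_of_polar (c := c) (z := z) (p := (t', ψ')) ht' (by rw [← heq]; rfl)
    (by rw [← heq]; rfl)
  rw [h1] at h3
  rw [h2] at h4
  simp only at h3 h4
  have hsq : ∀ {t : ℝ}, 1 < t → (√(t ^ 2 - 1) / t) ^ 2 = 1 - 1 / t ^ 2 := by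
    intro t ht
    rw [div_pow, Real.sq_sqrt (by nlinarith)]
    field_simp
  have hpos : 0 < √(t ^ 2 - 1) / t := div_pos (Real.sqrt_pos.2 (by nlinarith)) (by linarith)
  have ht2 : (√(t ^ 2 - 1) / t) ^ 2 = (√(t' ^ 2 - 1) / t') ^ 2 := by
    have e1 := cos_sq_add_sin_sq ψ
    have e2 := cos_sq_add_sin_sq ψ'
    have e3 := congrArg (· ^ 2) h3
    have e4 := congrArg (· ^ 2) h4
    simp only [mul_pow] at e3 e4
    linear_combination e3 + e4 - (√(t ^ 2 - 1) / t) ^ 2 * e1 + (√(t' ^ 2 - 1) / t') ^ 2 * e2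
  have htt : t = t' := by
    have e := ht2
    rw [hsq ht, hsq ht', sub_right_inj, one_div, one_div, inv_inj] at e
    exact (sq_eq_sq₀ (by linarith) (by linarith)).1 e
  subst htt
  have hc := mul_left_cancel₀ hpos.ne' h3
  have hs := mul_left_cancel₀ hpos.ne' h4
  rw [Prod.mk.injEq]
  refine ⟨rfl, ?_⟩
  rw [← Complex.arg_cos_add_sin_mul_I hψ, ← Complex.arg_cos_add_sin_mul_I hψ',
    ← Complex.ofReal_cos, ← Complex.ofReal_sin, hc, hs, Complex.ofReal_cos, Complex.ofReal_sin]

instance : NullSingletonClass (volume : Measure ℍ) := by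
  refine ⟨fun z ↦ ?_⟩
  rw [UpperHalfPlane.volume_eq_lintegral, image_singleton]
  exact setLIntegral_measure_zero _ _ (measure_singleton _)

/-- The hyperbolic area in polar coordinates. -/
lemma volume_eq_volume_polar (c : ℍ) {K : Set (ℝ × ℝ)} (hK : MeasurableSet K) :
    volume {z : ℍ | (kleinX c z, kleinY c z) ∈ K} = volume {p : ℝ × ℝ |
      (√(p.1 ^ 2 - 1) / p.1 * cos p.2, √(p.1 ^ 2 - 1) / p.1 * sin p.2) ∈ K ∧
      p ∈ Ioi (1 : ℝ) ×ˢ Ioc (-π) π} := by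
  set S := {z : ℍ | (kleinX c z, kleinY c z) ∈ K} with hS
  set A := {p : ℝ × ℝ | (√(p.1 ^ 2 - 1) / p.1 * cos p.2, √(p.1 ^ 2 - 1) / p.1 * sin p.2) ∈ K ∧
      p ∈ Ioi (1 : ℝ) ×ˢ Ioc (-π) π} with hA
  have hAm : MeasurableSet A := by
    refine MeasurableSet.inter ?_ (measurableSet_Ioi.prod measurableSet_Ioc)
    refine measurableSet_preimage (f := fun p : ℝ × ℝ ↦
      (√(p.1 ^ 2 - 1) / p.1 * cos p.2, √(p.1 ^ 2 - 1) / p.1 * sin p.2)) ?_ hK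
    fun_prop
  have himage : Complex.measurableEquivRealProd.symm ⁻¹' (UpperHalfPlane.coe '' (S \ {c})) =
      polar c '' A := by
    ext q
    constructor
    · rintro ⟨z, ⟨hzS, hzc⟩, hzq⟩
      obtain ⟨p, hp, h1, h2⟩ := exists_polar_eq hzc
      have hk := klein_of_polar (c := c) (z := z) hp.1 h1.symm h2.symm
      refine ⟨p, ⟨?_, hp⟩, ?_⟩
      · rw [← hk.1, ← hk.2]; exact hzS
      · ext
        · rw [h1, ← coe_re, hzq]; rfl
        · rw [h2, ← coe_im, hzq]; rfl
    · rintro ⟨p, ⟨hpK, hp⟩, rfl⟩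
      let z : ℍ := ⟨⟨(polar c p).1, (polar c p).2⟩, polar_snd_pos c hp.1⟩
      have hk := klein_of_polar (c := c) (z := z) hp.1 rfl rfl
      refine ⟨z, ⟨?_, ?_⟩, rfl⟩
      · rw [hS, mem_ofPred_eq, hk.1, hk.2]; exact hpK
      · rintro (hzc : z = c)
        rw [hzc, (klein_self c).1, (klein_self c).2] at hk
        have hp1 : 1 < p.1 := hp.1
        have hpos : 0 < √(p.1 ^ 2 - 1) / p.1 :=
          div_pos (Real.sqrt_pos.2 (by nlinarith)) (by linarith)
        have e1 := (mul_eq_zero.1 hk.1.symm).resolve_left hpos.ne'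
        have e2 := (mul_eq_zero.1 hk.2.symm).resolve_left hpos.ne'
        have e3 := cos_sq_add_sin_sq p.2
        rw [e1, e2] at e3
        norm_num at e3
  have hder : ∀ p ∈ A, HasFDerivWithinAt (polar c) (fderiv ℝ (polar c) p) A p := by
    intro p hp
    obtain ⟨L, hL, -⟩ := exists_hasFDerivAt_polar c (p := p) hp.2.1
    exact hL.differentiableAt.hasFDerivAt.hasFDerivWithinAt
  calc volume S = volume (S \ {c}) := (measure_sdiff_null (measure_singleton c)).symm
    _ = ∫⁻ q in polar c '' A,
          (((1 / ‖(Complex.measurableEquivRealProd.symm q).im‖₊) ^ 2 : NNReal) : ENNReal) := by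
        rw [UpperHalfPlane.volume_eq_lintegral, ← himage,
          ← Complex.volume_preserving_equiv_real_prod.symm.setLIntegral_comp_preimage_emb
            Complex.measurableEquivRealProd.symm.measurableEmbedding]
    _ = ∫⁻ p in A, 1 := by
        rw [lintegral_image_eq_lintegral_abs_det_fderiv_mul volume hAm hder
          ((polar_injOn c).mono fun p hp ↦ hp.2)]
        refine setLIntegral_congr_fun hAm fun p hp ↦ ?_
        obtain ⟨L, hL, hdet⟩ := exists_hasFDerivAt_polar c (p := p) hp.2.1
        have hpos := polar_snd_pos c (p := p) hp.2.1
        have him : (Complex.measurableEquivRealProd.symm (polar c p)).im = (polar c p).2 := rfl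
        rw [hL.fderiv, hdet, him, abs_of_pos (by positivity), ENNReal.ofReal,
          ← ENNReal.coe_mul, ← ENNReal.coe_one, ENNReal.coe_inj]
        ext
        rw [NNReal.coe_mul, Real.coe_toNNReal _ (by positivity)]
        simp only [NNReal.coe_pow, NNReal.coe_div, coe_nnnorm, Real.norm_eq_abs, abs_of_pos hpos,
          NNReal.coe_one]
        field_simp
    _ = volume A := by rw [setLIntegral_one]

end

/-! ### The area as a sum over right triangles -/

section

open Set Real

/-- The height function of a line at distance `artanh ρ` from the centre. -/
lemma volume_slice {ρ m : ℝ} (hρ : 0 < ρ) (hm : ρ < m) :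
    volume {t : ℝ | 1 < t ∧ √(t ^ 2 - 1) / t * m ≤ ρ} =
      ENNReal.ofReal (m / √(m ^ 2 - ρ ^ 2) - 1) := by
  have hd : 0 < m ^ 2 - ρ ^ 2 := by nlinarith
  have hd' := Real.sqrt_pos.2 hd
  have : {t : ℝ | 1 < t ∧ √(t ^ 2 - 1) / t * m ≤ ρ} = Ioc 1 (m / √(m ^ 2 - ρ ^ 2)) := by
    ext t
    refine and_congr_right fun ht ↦ ?_
    have ht0 : 0 < t := by linarith
    have hm0 : 0 < m := by linarith
    have hw : √(t ^ 2 - 1) ^ 2 = t ^ 2 - 1 := Real.sq_sqrt (by nlinarith)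
    rw [div_mul_eq_mul_div, div_le_iff₀ ht0, le_div_iff₀ hd',
      ← sq_le_sq₀ (a := √(t ^ 2 - 1) * m) (by positivity) (by positivity),
      ← sq_le_sq₀ (a := t * √(m ^ 2 - ρ ^ 2)) (by positivity) (by positivity),
      mul_pow, mul_pow, mul_pow, hw, Real.sq_sqrt hd.le]
    constructor <;> intro h <;> linarith
  rw [this, Real.volume_Ioc]

/-- The area of a right triangle with a leg `artanh ρ` and adjacent angle `θ`. -/
lemma setLIntegral_height {ρ θ : ℝ} (hρ : 0 < ρ) (hρ1 : ρ < 1) (hθ : 0 ≤ θ) (hθ2 : θ < π / 2)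
    (hc : ρ < cos θ) :
    ∫⁻ t in Icc 0 θ, ENNReal.ofReal (cos t / √(cos t ^ 2 - ρ ^ 2) - 1) =
      ENNReal.ofReal (arcsin (sin θ / √(1 - ρ ^ 2)) - θ) ∧
    0 ≤ arcsin (sin θ / √(1 - ρ ^ 2)) - θ := by
  have hC : 0 < 1 - ρ ^ 2 := by nlinarith
  have hC' := Real.sqrt_pos.2 hC
  have hcos : ∀ t ∈ Icc 0 θ, ρ < cos t := fun t ht ↦
    hc.trans_le (cos_le_cos_of_nonneg_of_le_pi ht.1 (by linarith [pi_pos]) ht.2)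
  have hpos : ∀ t ∈ Icc 0 θ, 0 < cos t ^ 2 - ρ ^ 2 := fun t ht ↦ by nlinarith [hcos t ht]
  have hnn : ∀ t ∈ Icc 0 θ, 0 ≤ cos t / √(cos t ^ 2 - ρ ^ 2) - 1 := fun t ht ↦ by
    rw [sub_nonneg, one_le_div (Real.sqrt_pos.2 (hpos t ht))]
    exact Real.sqrt_le_iff.2 ⟨by linarith [hcos t ht], by nlinarith⟩
  have hcont : ContinuousOn (fun t ↦ cos t / √(cos t ^ 2 - ρ ^ 2) - 1) (Icc 0 θ) := by
    refine (ContinuousOn.div (by fun_prop) (by fun_prop) fun t ht ↦ ?_).sub continuousOn_const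
    exact (Real.sqrt_pos.2 (hpos t ht)).ne'
  -- The antiderivative is the angle defect of the right triangle, since `1 / √(1 - ρ ^ 2) = cosh r`
  -- for `ρ = tanh r`.
  have hder : ∀ t ∈ Icc 0 θ, HasDerivAt (fun t ↦ arcsin (sin t / √(1 - ρ ^ 2)) - t)
      (cos t / √(cos t ^ 2 - ρ ^ 2) - 1) t := by
    intro t ht
    have hp := hpos t ht
    have hcs := cos_sq_add_sin_sq t
    have hlt : (sin t / √(1 - ρ ^ 2)) ^ 2 < 1 := by
      rw [div_pow, Real.sq_sqrt hC.le, div_lt_one hC]; linarith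
    have habs := abs_lt.1 ((sq_lt_one_iff_abs_lt_one _).1 hlt)
    have h1 := (hasDerivAt_arcsin habs.1.ne' habs.2.ne).comp t
      ((hasDerivAt_sin t).div_const (√(1 - ρ ^ 2)))
    have h2 : √(1 - (sin t / √(1 - ρ ^ 2)) ^ 2) * √(1 - ρ ^ 2) = √(cos t ^ 2 - ρ ^ 2) := by
      rw [← Real.sqrt_mul (by linarith), div_pow, Real.sq_sqrt hC.le]
      congr 1
      field_simp
      linarith
    refine (h1.sub (hasDerivAt_id t)).congr_deriv ?_
    rw [← h2]
    ring
  have hint : ∫ t in (0 : ℝ)..θ, (cos t / √(cos t ^ 2 - ρ ^ 2) - 1) =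
      arcsin (sin θ / √(1 - ρ ^ 2)) - θ := by
    rw [intervalIntegral.integral_eq_sub_of_hasDerivAt
      (f := fun t ↦ arcsin (sin t / √(1 - ρ ^ 2)) - t)
      (by rwa [uIcc_of_le hθ]) (by
        apply ContinuousOn.intervalIntegrable; rwa [uIcc_of_le hθ])]
    simp
  rw [intervalIntegral.integral_of_le hθ, ← integral_Icc_eq_integral_Ioc] at hint
  refine ⟨?_, ?_⟩
  · rw [← ofReal_integral_eq_lintegral_ofReal (hcont.integrableOn_compact isCompact_Icc)
      ((ae_restrict_iff' measurableSet_Icc).2 (ae_of_all _ hnn)), hint]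
  · rw [← hint]
    exact setIntegral_nonneg measurableSet_Icc hnn

namespace IsCircumscribed

variable {n : ℕ} {ρ : ℝ} {φ x y : Fin n → ℝ} (h : IsCircumscribed ρ φ x y)

include h

lemma lt_one : ρ < 1 := by
  have i : Fin n := ⟨0, by linarith [h.three_le]⟩
  exact (h.lt_cos_halfAngle i).trans_le (cos_le_one _)

/-- The ray leaves the polygon at a point between two vertices of the open disc, at Euclidean
distance `ρ / cos t`, which is therefore less than `1`. -/
lemma lt_cos_of_mem_sector {i : Fin n} {t : ℝ} (ht : φ i + t ∈ sector φ i) : ρ < cos t := by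
  have h1 := (h.forall_cos_le_iff i t).1 (by simpa [sector] using ht)
  have hL : ρ ^ 2 + tanLeft φ x y i ^ 2 < 1 := h.sq_add_sq_left i ▸ h.sq_lt_one i
  have hR : ρ ^ 2 + tanRight φ x y i ^ 2 < 1 := h.sq_add_sq_right i ▸ h.sq_lt_one _
  have hLR := h.tanLeft_mul_tanRight_neg i
  have h2 : ρ ^ 2 + (ρ * tan t) ^ 2 < 1 := by
    set τ := ρ * tan t
    set L := tanLeft φ x y i
    set R := tanRight φ x y i
    rcases mul_nonpos_iff.1 h1.2 with h3 | h3 <;> rcases le_total 0 τ with h4 | h4 <;>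
      rcases mul_neg_iff.1 hLR with h5 | h5 <;> nlinarith
  have h3 := h1.1
  have h4 := h.pos
  rw [tan_eq_sin_div_cos] at h2
  have h5 : ρ ^ 2 + (ρ * (sin t / cos t)) ^ 2 = ρ ^ 2 / cos t ^ 2 := by
    have := cos_sq_add_sin_sq t
    field_simp
    linear_combination this
  rw [h5, div_lt_one (by positivity), sq_lt_sq₀ h4.le h3.le] at h2
  exact h2

/-- Fubini in polar coordinates: in sector `i` the constraint of side `i` implies all others, so the
slice in direction `φ i + t` depends on `cos t` only. -/
lemma volume_eq_sum (c : ℍ) :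
    (volume : Measure ℍ).real
        {z | ∀ i, cos (φ i) * kleinX c z + sin (φ i) * kleinY c z ≤ ρ} =
      2 * ∑ i, arcsin (sin (halfAngle ρ φ x y i) / √(1 - ρ ^ 2)) - 2 * π := by
  set K : Set (ℝ × ℝ) := {q | ∀ i, cos (φ i) * q.1 + sin (φ i) * q.2 ≤ ρ} with hK_def
  have hK : MeasurableSet K := by
    refine IsClosed.measurableSet ?_
    simp only [hK_def, ofPred_forall]
    exact isClosed_iInter fun j ↦ isClosed_le (by fun_prop) (by fun_prop)
  have hvol : volume {z : ℍ | ∀ i, cos (φ i) * kleinX c z + sin (φ i) * kleinY c z ≤ ρ} =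
      ∫⁻ ψ in Ioc (-π) π,
        volume {t : ℝ | 1 < t ∧ ∀ i, √(t ^ 2 - 1) / t * cos (ψ - φ i) ≤ ρ} := by
    have hslice : ∀ t ψ : ℝ, (√(t ^ 2 - 1) / t * cos ψ, √(t ^ 2 - 1) / t * sin ψ) ∈ K ↔
        ∀ i, √(t ^ 2 - 1) / t * cos (ψ - φ i) ≤ ρ := by
      intro t ψ
      refine forall_congr' fun i ↦ ?_
      rw [cos_sub]
      simp only
      rw [show ∀ a b c d e : ℝ, a * (b * c) + d * (b * e) = b * (c * a + e * d) by intros; ring]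
    have hm : MeasurableSet {p : ℝ × ℝ |
        (√(p.1 ^ 2 - 1) / p.1 * cos p.2, √(p.1 ^ 2 - 1) / p.1 * sin p.2) ∈ K ∧
        p ∈ Ioi (1 : ℝ) ×ˢ Ioc (-π) π} := by
      refine MeasurableSet.inter ?_ (measurableSet_Ioi.prod measurableSet_Ioc)
      refine measurableSet_preimage (f := fun p : ℝ × ℝ ↦
        (√(p.1 ^ 2 - 1) / p.1 * cos p.2, √(p.1 ^ 2 - 1) / p.1 * sin p.2)) ?_ hK
      fun_prop
    have h1 := volume_eq_volume_polar c hK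
    rw [Measure.volume_eq_prod, Measure.prod_apply_symm hm] at h1
    refine h1.trans ?_
    rw [← lintegral_indicator measurableSet_Ioc]
    refine lintegral_congr fun ψ ↦ ?_
    by_cases hψ : ψ ∈ Ioc (-π) π
    · rw [indicator_of_mem hψ]
      congr 1
      ext t
      simp only [mem_preimage, mem_ofPred_eq, hslice, mem_prod, mem_Ioi, hψ, and_true]
      exact and_comm
    · rw [indicator_of_notMem hψ]
      refine (congrArg volume (eq_empty_of_forall_notMem fun t ht ↦ hψ ?_)).trans measure_empty
      exact ht.2.2
  have hF := h.setLIntegral_eq_sum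
    (F := fun ψ ↦ volume {t : ℝ | 1 < t ∧ ∀ i, √(t ^ 2 - 1) / t * cos (ψ - φ i) ≤ ρ})
    (g := fun m ↦ ENNReal.ofReal (m / √(m ^ 2 - ρ ^ 2) - 1))
    (fun ψ ↦ by simp only [add_sub_right_comm, cos_add_two_pi])
    (fun i t ht ↦ by
      rw [← volume_slice h.pos (h.lt_cos_of_mem_sector ht)]
      congr 1
      ext s
      refine and_congr_right fun hs ↦ ⟨fun h1 ↦ by simpa using h1 i, fun h1 j ↦ le_trans ?_ h1⟩
      refine mul_le_mul_of_nonneg_left ?_ (div_nonneg (Real.sqrt_nonneg _) (by linarith))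
      simpa using ht j)
  have htri := fun i ↦ setLIntegral_height h.pos h.lt_one (h.halfAngle_pos i).le (halfAngle_lt i)
    (h.lt_cos_halfAngle i)
  rw [measureReal_def, hvol, hF, Finset.sum_congr rfl fun i _ ↦ (htri i).1,
    ← ENNReal.ofReal_sum_of_nonneg fun i _ ↦ (htri i).2, ENNReal.toReal_mul,
    ENNReal.toReal_ofReal (Finset.sum_nonneg fun i _ ↦ (htri i).2), Finset.sum_sub_distrib,
    h.sum_halfAngle]
  simp
  ring

end IsCircumscribed

end

section

/-! ### Side lengths and interior angles -/

section klein

variable {c z u w : ℍ} {D D' e₁ e₂ e₁' e₂' : ℝ}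

lemma cosh_sq_mul_klein (c z : ℍ) :
    Real.cosh (dist c z) ^ 2 * (1 - (kleinX c z ^ 2 + kleinY c z ^ 2)) = 1 := by
  have := Real.cosh_pos (dist c z)
  rw [klein_sq]
  field_simp
  ring

/-- By the law of cosines the left side is `sinh * sinh * cos` of the angle at `z`; the last factor
on the right is, up to scale, the Klein metric at `z` on the directions `e`, `e'`. -/
lemma cosh_mul_cosh_sub_cosh (hu₁ : kleinX c u = kleinX c z + D * e₁)
    (hu₂ : kleinY c u = kleinY c z + D * e₂) (hw₁ : kleinX c w = kleinX c z + D' * e₁')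
    (hw₂ : kleinY c w = kleinY c z + D' * e₂') :
    Real.cosh (dist z u) * Real.cosh (dist z w) - Real.cosh (dist u w) =
      Real.cosh (dist c z) ^ 2 * Real.cosh (dist c u) * Real.cosh (dist c w) * (D * D') *
        ((kleinX c z * e₁ + kleinY c z * e₂) * (kleinX c z * e₁' + kleinY c z * e₂') +
          (1 - (kleinX c z ^ 2 + kleinY c z ^ 2)) * (e₁ * e₁' + e₂ * e₂')) := by
  have h := cosh_sq_mul_klein c z
  rw [cosh_dist_klein c z u, cosh_dist_klein c z w, cosh_dist_klein c u w, hu₁, hu₂, hw₁, hw₂]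
  linear_combination (Real.cosh (dist c u) * Real.cosh (dist c w) *
    (1 - ((kleinX c z + D * e₁) * (kleinX c z + D' * e₁') +
      (kleinY c z + D * e₂) * (kleinY c z + D' * e₂')))) * h

lemma sinh_dist_klein (hu₁ : kleinX c u = kleinX c z + D * e₁)
    (hu₂ : kleinY c u = kleinY c z + D * e₂) :
    Real.sinh (dist z u) = Real.cosh (dist c z) * Real.cosh (dist c u) * |D| *
      √((kleinX c z * e₁ + kleinY c z * e₂) ^ 2 +
          (1 - (kleinX c z ^ 2 + kleinY c z ^ 2)) * (e₁ ^ 2 + e₂ ^ 2)) := by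
  have h1 := Real.cosh_pos (dist c z)
  have h2 := Real.cosh_pos (dist c u)
  have h3 := klein_sq_lt_one c z
  rw [← sq_eq_sq₀ (Real.sinh_nonneg_iff.2 dist_nonneg) (by positivity), mul_pow, mul_pow, mul_pow,
    sq_abs, Real.sq_sqrt (add_nonneg (sq_nonneg _) (mul_nonneg (by linarith) (by positivity))),
    Real.sinh_sq]
  have h := cosh_mul_cosh_sub_cosh hu₁ hu₂ hu₁ hu₂
  rw [dist_self, Real.cosh_zero] at h
  linear_combination h

/-- The angle between two sides whose lines are at the same distance from the centre. -/
lemma cos_angleAt_klein {ρ τ : ℝ} (hu₁ : kleinX c u = kleinX c z + D * e₁)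
    (hu₂ : kleinY c u = kleinY c z + D * e₂) (hw₁ : kleinX c w = kleinX c z + D' * e₁')
    (hw₂ : kleinY c w = kleinY c z + D' * e₂') (hD : D * D' < 0) (he : e₁ ^ 2 + e₂ ^ 2 = 1)
    (he' : e₁' ^ 2 + e₂' ^ 2 = 1) (hze : kleinX c z * e₁ + kleinY c z * e₂ = -τ)
    (hze' : kleinX c z * e₁' + kleinY c z * e₂' = τ)
    (hz : kleinX c z ^ 2 + kleinY c z ^ 2 = ρ ^ 2 + τ ^ 2) (hρ : 0 < 1 - ρ ^ 2) :
    (1 - ρ ^ 2) * Real.cos (angleAt z u w) =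
      τ ^ 2 - (1 - (ρ ^ 2 + τ ^ 2)) * (e₁ * e₁' + e₂ * e₂') := by
  have hzu : u ≠ z := by
    rintro rfl
    rw [left_eq_add, mul_eq_zero, or_iff_right (left_ne_zero_of_mul hD.ne)] at hu₁ hu₂
    rw [hu₁, hu₂] at he
    norm_num at he
  have hzw : w ≠ z := by
    rintro rfl
    rw [left_eq_add, mul_eq_zero, or_iff_right (right_ne_zero_of_mul hD.ne)] at hw₁ hw₂
    rw [hw₁, hw₂] at he'
    norm_num at he'
  have hE := cosh_mul_cosh_sub_cosh hu₁ hu₂ hw₁ hw₂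
  have hs := sinh_dist_klein hu₁ hu₂
  have hs' := sinh_dist_klein hw₁ hw₂
  rw [hze, he, hz, mul_one, neg_sq, show τ ^ 2 + (1 - (ρ ^ 2 + τ ^ 2)) = 1 - ρ ^ 2 by ring] at hs
  rw [hze', he', hz, mul_one, show τ ^ 2 + (1 - (ρ ^ 2 + τ ^ 2)) = 1 - ρ ^ 2 by ring] at hs'
  rw [cosh_dist_eq_angleAt hzu hzw, sub_sub_cancel, hs, hs', hze, hze', hz] at hE
  have h1 := Real.cosh_pos (dist c z)
  have h2 := Real.cosh_pos (dist c u)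
  have h3 := Real.cosh_pos (dist c w)
  have hab : |D| * |D'| = -(D * D') := by rw [← abs_mul, abs_of_neg hD]
  have hne : Real.cosh (dist c z) ^ 2 * Real.cosh (dist c u) * Real.cosh (dist c w) *
      (D * D') ≠ 0 :=
    mul_ne_zero (by positivity) hD.ne
  have hsqrt := Real.sq_sqrt hρ.le
  generalize √(1 - ρ ^ 2) = q at *
  refine mul_left_cancel₀ hne ?_
  rw [← hsqrt]
  linear_combination (-1) * hE + (Real.cosh (dist c z) ^ 2 * Real.cosh (dist c u) *
    Real.cosh (dist c w)) * q ^ 2 * Real.cos (angleAt z u w) * hab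

end klein

namespace IsCircumscribed

variable {n : ℕ} {ρ : ℝ} {φ x y : Fin n → ℝ} (h : IsCircumscribed ρ φ x y)

include h

/-- Were the signs equal, the rotation taking one normal to the next would fix the common vertex,
which is not the origin; the two normals would coincide. -/
lemma tanRight_eq_neg (i : Fin n) : tanRight φ x y i = -tanLeft φ x y (finRotate n i) := by
  refine (sq_eq_sq_iff_eq_or_eq_neg.1 (h.tanRight_sq i)).resolve_left fun heq ↦ ?_
  have h1 := (h.left_value (finRotate n i) i).trans (h.eq_right i)
  have h2 : tanRight φ x y i = ρ * Real.sin (φ (finRotate n i) - φ i) +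
      tanLeft φ x y (finRotate n i) * Real.cos (φ (finRotate n i) - φ i) := by
    rw [tanRight, (h.left_eq (finRotate n i)).1, (h.left_eq (finRotate n i)).2, Real.sin_sub,
      Real.cos_sub]
    ring
  have h3 := h.value_prev_right_lt i
  have h4 := h.pos
  rw [heq] at h2
  rw [← neg_sub (φ (finRotate n i)), Real.sin_neg] at h1 h3
  have h5 : (ρ ^ 2 + tanLeft φ x y (finRotate n i) ^ 2) *
      (Real.cos (φ (finRotate n i) - φ i) - 1) = 0 := by
    linear_combination ρ * h1 - tanLeft φ x y (finRotate n i) * h2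
  have h6 := (mul_eq_zero.1 h5).resolve_left (by positivity)
  have h7 : Real.cos (φ (finRotate n i) - φ i) = 1 := by linarith
  have h8 : Real.sin (φ (finRotate n i) - φ i) = 0 :=
    Real.sin_eq_zero_iff_cos_eq.2 (Or.inl h7)
  rw [h7, h8] at h3
  simp at h3

/-- Up to sign, consecutive normals differ by twice the half-angle `θ` at their common vertex; this
is `cos (2 * θ)` in terms of `tan θ`. -/
lemma cos_normal_sub (i : Fin n) :
    (ρ ^ 2 + tanLeft φ x y (finRotate n i) ^ 2) * Real.cos (φ (finRotate n i) - φ i) =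
      ρ ^ 2 - tanLeft φ x y (finRotate n i) ^ 2 := by
  have h1 := (h.left_value (finRotate n i) i).trans (h.eq_right i)
  have h2 : tanRight φ x y i = ρ * Real.sin (φ (finRotate n i) - φ i) +
      tanLeft φ x y (finRotate n i) * Real.cos (φ (finRotate n i) - φ i) := by
    rw [tanRight, (h.left_eq (finRotate n i)).1, (h.left_eq (finRotate n i)).2, Real.sin_sub,
      Real.cos_sub]
    ring
  rw [h.tanRight_eq_neg] at h2
  rw [← neg_sub (φ (finRotate n i)), Real.sin_neg] at h1
  linear_combination ρ * h1 - tanLeft φ x y (finRotate n i) * h2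

lemma sin_halfAngle_sq (i : Fin n) : (ρ ^ 2 + tanLeft φ x y i ^ 2) *
    Real.sin (halfAngle ρ φ x y i) ^ 2 = tanLeft φ x y i ^ 2 := by
  have h1 := h.cos_halfAngle_sq i
  rw [h.sq_add_sq_left] at h1
  rw [Real.sin_sq]
  linear_combination -h1

end IsCircumscribed

variable {n : ℕ} {ρ : ℝ} {φ : Fin n → ℝ} {P : Polygon ℍ n} {c : ℍ}

open IsCircumscribed

section

variable (h : IsCircumscribed ρ φ (fun i ↦ kleinX c (P i)) (fun i ↦ kleinY c (P i)))

include h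

/-- The double-angle form of the right-triangle relation `cos β = sin θ * cosh r`, where `β` is half
the interior angle and `cosh r ^ 2 = 1 / (1 - ρ ^ 2)`. -/
lemma cos_interiorAngle (i : Fin n) : Real.cos (interiorAngle P i) =
    2 * Real.sin (halfAngle ρ φ (fun i ↦ kleinX c (P i)) (fun i ↦ kleinY c (P i)) i) ^ 2 /
      (1 - ρ ^ 2) - 1 := by
  obtain ⟨m, rfl⟩ := (finRotate n).surjective i
  rw [interiorAngle, Equiv.symm_apply_apply]
  have hL := h.left_eq m
  have hR := h.right_eq m
  have hL' := h.left_eq (finRotate n m)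
  have hR' := h.right_eq (finRotate n m)
  have hneg := h.tanRight_eq_neg m
  have hn1 := h.tanLeft_mul_tanRight_neg m
  have hn2 := h.tanLeft_mul_tanRight_neg (finRotate n m)
  have hcos := h.cos_normal_sub m
  have hsin := h.sin_halfAngle_sq (finRotate n m)
  have hsq := h.sq_add_sq_left (finRotate n m)
  have hlt := h.sq_lt_one (finRotate n m)
  have hρ := h.pos
  have hρ1 := h.lt_one
  have ez : tanRight φ (fun i ↦ kleinX c (P i)) (fun i ↦ kleinY c (P i)) m =
      kleinX c (P (finRotate n m)) * -Real.sin (φ m) +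
        kleinY c (P (finRotate n m)) * Real.cos (φ m) := by rw [tanRight]; ring
  have ez' : tanLeft φ (fun i ↦ kleinX c (P i)) (fun i ↦ kleinY c (P i)) (finRotate n m) =
      kleinX c (P (finRotate n m)) * -Real.sin (φ (finRotate n m)) +
        kleinY c (P (finRotate n m)) * Real.cos (φ (finRotate n m)) := by rw [tanLeft]; ring
  set θ := halfAngle ρ φ (fun i ↦ kleinX c (P i)) (fun i ↦ kleinY c (P i)) (finRotate n m)
  set L := tanLeft φ (fun i ↦ kleinX c (P i)) (fun i ↦ kleinY c (P i)) m
  set R := tanRight φ (fun i ↦ kleinX c (P i)) (fun i ↦ kleinY c (P i)) m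
  set L' := tanLeft φ (fun i ↦ kleinX c (P i)) (fun i ↦ kleinY c (P i)) (finRotate n m)
  set R' := tanRight φ (fun i ↦ kleinX c (P i)) (fun i ↦ kleinY c (P i)) (finRotate n m)
  beta_reduce at hL hR hL' hR' hsq hlt
  have hu₁ : kleinX c (P m) = kleinX c (P (finRotate n m)) + (L - R) * -Real.sin (φ m) := by
    rw [hL.1, hR.1]; ring
  have hu₂ : kleinY c (P m) = kleinY c (P (finRotate n m)) + (L - R) * Real.cos (φ m) := by
    rw [hL.2, hR.2]; ring
  have hw₁ : kleinX c (P (finRotate n (finRotate n m))) = kleinX c (P (finRotate n m)) +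
      (R' - L') * -Real.sin (φ (finRotate n m)) := by
    rw [hL'.1, hR'.1]; ring
  have hw₂ : kleinY c (P (finRotate n (finRotate n m))) = kleinY c (P (finRotate n m)) +
      (R' - L') * Real.cos (φ (finRotate n m)) := by
    rw [hL'.2, hR'.2]; ring
  -- One side is traversed backwards from the vertex and the other forwards, so the signed
  -- displacements are opposite.
  have hDD : (L - R) * (R' - L') < 0 := by
    have hp : 0 < L'⁻¹ ^ 2 := by
      have : L' ≠ 0 := by rintro h0; rw [h0] at hn2; simp at hn2
      positivity
    rw [hneg] at hn1 ⊢
    have a1 : 0 < L' * (L - -L') := by nlinarith [sq_nonneg L']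
    have a2 : L' * (R' - L') < 0 := by nlinarith [sq_nonneg L']
    have a3 := mul_neg_of_pos_of_neg a1 a2
    by_contra! a4
    nlinarith [mul_nonneg (sq_nonneg L') a4]
  have hρ2 : 0 < 1 - ρ ^ 2 := by nlinarith
  have hang := cos_angleAt_klein hu₁ hu₂ hw₁ hw₂ hDD
    (by rw [neg_sq, add_comm, Real.cos_sq_add_sin_sq])
    (by rw [neg_sq, add_comm, Real.cos_sq_add_sin_sq]) (ez.symm.trans hneg) ez'.symm hsq hρ2
  rw [show -Real.sin (φ m) * -Real.sin (φ (finRotate n m)) +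
      Real.cos (φ m) * Real.cos (φ (finRotate n m)) = Real.cos (φ (finRotate n m) - φ m) by
    rw [Real.cos_sub]; ring] at hang
  have hden : 0 < ρ ^ 2 + L' ^ 2 := by positivity
  rw [eq_div_of_mul_eq hden.ne' ((mul_comm _ _).trans hcos)] at hang
  rw [eq_div_of_mul_eq hden.ne' ((mul_comm _ _).trans hsin),
    ← mul_right_inj' hρ2.ne', hang]
  field_simp
  ring

/-- Shows that, for given `ρ`, a side length depends only on the half-angles at its two ends. -/
lemma cosh_sideLength {θ : Fin n → ℝ}
    (hθ : θ = halfAngle ρ φ (fun i ↦ kleinX c (P i)) (fun i ↦ kleinY c (P i))) (i : Fin n) :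
    Real.cosh (sideLength P i) ^ 2 * ((1 - (ρ ^ 2 + (ρ * Real.tan (θ i)) ^ 2)) *
      (1 - (ρ ^ 2 + (ρ * Real.tan (θ (finRotate n i))) ^ 2))) =
    (1 - (ρ ^ 2 - (ρ * Real.tan (θ i)) * (ρ * Real.tan (θ (finRotate n i))))) ^ 2 := by
  subst hθ
  have hL := h.left_eq i
  have hR := h.right_eq i
  have hs := h.sq_add_sq_left i
  have hs' := h.sq_add_sq_left (finRotate n i)
  have habs : |tanLeft φ (fun i ↦ kleinX c (P i)) (fun i ↦ kleinY c (P i)) i| *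
      |tanLeft φ (fun i ↦ kleinX c (P i)) (fun i ↦ kleinY c (P i)) (finRotate n i)| =
      -(tanLeft φ (fun i ↦ kleinX c (P i)) (fun i ↦ kleinY c (P i)) i *
      tanRight φ (fun i ↦ kleinX c (P i)) (fun i ↦ kleinY c (P i)) i) := by
    rw [← abs_of_neg (h.tanLeft_mul_tanRight_neg i), h.tanRight_eq_neg, abs_mul, abs_neg]
  beta_reduce at hL hR hs hs'
  rw [h.tan_halfAngle, h.tan_halfAngle, sq_abs, sq_abs, ← hs, ← hs', habs, sideLength,
    cosh_dist_klein c]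
  have h1 := cosh_sq_mul_klein c (P i)
  have h2 := cosh_sq_mul_klein c (P (finRotate n i))
  have h3 : kleinX c (P i) * kleinX c (P (finRotate n i)) +
      kleinY c (P i) * kleinY c (P (finRotate n i)) = ρ ^ 2 +
      tanLeft φ (fun i ↦ kleinX c (P i)) (fun i ↦ kleinY c (P i)) i *
      tanRight φ (fun i ↦ kleinX c (P i)) (fun i ↦ kleinY c (P i)) i := by
    rw [hL.1, hL.2, hR.1, hR.2]
    linear_combination (ρ ^ 2 + tanLeft φ (fun i ↦ kleinX c (P i)) (fun i ↦ kleinY c (P i)) i *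
      tanRight φ (fun i ↦ kleinX c (P i)) (fun i ↦ kleinY c (P i)) i) *
      Real.cos_sq_add_sin_sq (φ i)
  rw [h3, sub_neg_eq_add]
  rw [mul_pow, mul_pow, mul_right_comm, mul_mul_mul_comm, h1, h2, one_mul, one_mul]

/-- Equal interior angles alone force equal half-angles, `sin` being injective on the acute ones;
conversely the half-angles determine both side lengths and interior angles. -/
lemma isRegular_iff : IsRegular P ↔ ∀ i j,
    halfAngle ρ φ (fun i ↦ kleinX c (P i)) (fun i ↦ kleinY c (P i)) i =
      halfAngle ρ φ (fun i ↦ kleinX c (P i)) (fun i ↦ kleinY c (P i)) j := by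
  have hρ2 : 0 < 1 - ρ ^ 2 := by nlinarith [h.pos, h.lt_one]
  have hang : ∀ i, interiorAngle P i ∈ Set.Icc 0 Real.pi := fun i ↦
    ⟨InnerProductGeometry.angle_nonneg _ _, InnerProductGeometry.angle_le_pi _ _⟩
  refine ⟨fun hreg i j ↦ ?_, fun heq ↦ ⟨fun i j ↦ ?_, fun i j ↦ ?_⟩⟩
  · have h1 := congrArg Real.cos (hreg.2 i j)
    rw [cos_interiorAngle h, cos_interiorAngle h, sub_left_inj, div_left_inj' hρ2.ne',
      mul_right_inj' two_ne_zero] at h1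
    have hi := halfAngle_lt (ρ := ρ) (φ := φ) (x := fun i ↦ kleinX c (P i))
      (y := fun i ↦ kleinY c (P i)) i
    have hj := halfAngle_lt (ρ := ρ) (φ := φ) (x := fun i ↦ kleinX c (P i))
      (y := fun i ↦ kleinY c (P i)) j
    have hi' := h.halfAngle_pos i
    have hj' := h.halfAngle_pos j
    rw [sq_eq_sq₀ (Real.sin_nonneg_of_nonneg_of_le_pi hi'.le (by linarith))
      (Real.sin_nonneg_of_nonneg_of_le_pi hj'.le (by linarith))] at h1
    exact Real.injOn_sin ⟨by linarith, by linarith⟩ ⟨by linarith, by linarith⟩ h1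
  · have h1 := cosh_sideLength h rfl i
    have h2 := cosh_sideLength h rfl j
    rw [heq (finRotate n i) i] at h1
    rw [heq (finRotate n j) j, heq j i, ← h1] at h2
    have h3 := h.sq_lt_one i
    rw [h.sq_add_sq_left, ← sq_abs (tanLeft _ _ _ _), ← h.tan_halfAngle] at h3
    have h4 := mul_right_cancel₀ (mul_pos (sub_pos.2 h3) (sub_pos.2 h3)).ne' h2
    rw [sq_eq_sq₀ (Real.cosh_pos _).le (Real.cosh_pos _).le] at h4
    exact Real.cosh_injOn (x₁ := sideLength P i) dist_nonneg dist_nonneg h4.symm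
  · refine Real.injOn_cos (hang i) (hang j) ?_
    rw [cos_interiorAngle h, cos_interiorAngle h, heq i j]

end

/-- The area of a tangential polygon in terms of its inradius and of the angles at the centre. -/
lemma IsTangentialWithInradius.exists_angles {r : ℝ} (hP : IsTangentialWithInradius P r) :
    0 < r ∧ ∃ θ : Fin n → ℝ,
      (∀ i, 0 < θ i ∧ θ i < Real.pi / 2 ∧ Real.sin (θ i) * Real.cosh r < 1) ∧
      ∑ i, θ i = Real.pi ∧
      area P = 2 * ∑ i, Real.arcsin (Real.sin (θ i) * Real.cosh r) - 2 * Real.pi ∧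
      (IsRegular P ↔ ∀ i j, θ i = θ j) := by
  obtain ⟨hconv, c, hc⟩ := hP
  obtain ⟨φ, h, hreg⟩ := exists_isCircumscribed hconv hc
  have hr := Real.cosh_pos r
  have hcosh : 1 / √(1 - Real.tanh r ^ 2) = Real.cosh r := by
    rw [tanh_sq, sub_sub_cancel, ← one_div_pow, Real.sqrt_sq (by positivity), one_div_one_div]
  refine ⟨hc.1, _, fun i ↦ ⟨h.halfAngle_pos i, halfAngle_lt i, ?_⟩, h.sum_halfAngle, ?_,
    isRegular_iff h⟩
  · have h1 := h.lt_cos_halfAngle i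
    have h2 := h.pos
    have h3 := tanh_sq r
    refine lt_of_pow_lt_pow_left₀ 2 zero_le_one ?_
    rw [mul_pow, one_pow, ← lt_div_iff₀ (by positivity), Real.sin_sq]
    nlinarith
  · rw [area, hreg, h.volume_eq_sum]
    simp only [← hcosh, mul_one_div]

end

/-! ### Strict convexity and Jensen's inequality -/

section

open Real Set

/-- The squared derivative is `C ^ 2 * (1 - u) / (1 - C ^ 2 * u)` with `u = sin θ ^ 2`, increasing
in `u` because `C > 1`. -/
lemma strictConvexOn_arcsin_mul_sin {C b : ℝ} (hC : 1 < C) (hb : b < π / 2) (hCb : sin b * C < 1) :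
    StrictConvexOn ℝ (Icc 0 b) fun θ ↦ arcsin (sin θ * C) := by
  refine StrictMonoOn.strictConvexOn_of_deriv (convex_Icc 0 b)
    (continuous_arcsin.comp (by fun_prop)).continuousOn ?_
  rw [interior_Icc]
  have hs : ∀ t ∈ Ioo 0 b, 0 < sin t ∧ sin t * C < 1 := fun t ht ↦
    ⟨sin_pos_of_pos_of_lt_pi ht.1 (by linarith [ht.2, pi_pos]),
      lt_of_le_of_lt (mul_le_mul_of_nonneg_right (sin_le_sin_of_le_of_le_pi_div_two
        (by linarith [ht.1, pi_pos]) hb.le ht.2.le) (by linarith)) hCb⟩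
  have hsq : ∀ t ∈ Ioo 0 b, 0 < 1 - (sin t * C) ^ 2 := fun t ht ↦ by
    have := mul_pos (hs t ht).1 (zero_lt_one.trans hC)
    nlinarith [(hs t ht).2]
  have hder : ∀ t ∈ Ioo 0 b,
      deriv (fun θ ↦ arcsin (sin θ * C)) t = cos t * C / √(1 - (sin t * C) ^ 2) := by
    intro t ht
    have h1 := mul_pos (hs t ht).1 (zero_lt_one.trans hC)
    have h2 := (hasDerivAt_arcsin (by linarith : sin t * C ≠ -1) (hs t ht).2.ne).comp t
      ((hasDerivAt_sin t).mul_const C)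
    exact h2.deriv.trans (by ring)
  intro x hx y hy hxy
  have hcx : 0 < cos x := cos_pos_of_mem_Ioo ⟨by linarith [hx.1, pi_pos], by linarith [hx.2]⟩
  have hcy : 0 < cos y := cos_pos_of_mem_Ioo ⟨by linarith [hy.1, pi_pos], by linarith [hy.2]⟩
  have hlt : sin x < sin y := sin_lt_sin_of_lt_of_le_pi_div_two (by linarith [hx.1, pi_pos])
    (by linarith [hy.2]) hxy
  rw [hder x hx, hder y hy, div_lt_div_iff₀ (sqrt_pos.2 (hsq x hx)) (sqrt_pos.2 (hsq y hy)),
    ← sq_lt_sq₀ (by positivity) (by positivity), mul_pow (cos x * C),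
    mul_pow (cos y * C), sq_sqrt (hsq x hx).le, sq_sqrt (hsq y hy).le, mul_pow (cos x),
    mul_pow (cos y), cos_sq', cos_sq']
  have h1 : sin x ^ 2 < sin y ^ 2 := by
    rw [sq_lt_sq₀ (hs x hx).1.le (hs y hy).1.le]; exact hlt
  have h2 : 0 < C ^ 2 * ((sin y ^ 2 - sin x ^ 2) * (C ^ 2 - 1)) :=
    mul_pos (by positivity) (mul_pos (by linarith) (by nlinarith))
  linarith

/-- In the derivative `s * sinh r / √(1 - (s * cosh r) ^ 2)` the numerator increases strictly and
the denominator decreases. -/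
lemma strictConvexOn_arcsin_mul_cosh {s b : ℝ} (hs : 0 < s) (hsb : s * cosh b < 1) :
    StrictConvexOn ℝ (Icc 0 b) fun r ↦ arcsin (s * cosh r) := by
  refine StrictMonoOn.strictConvexOn_of_deriv (convex_Icc 0 b)
    (continuous_arcsin.comp (by fun_prop)).continuousOn ?_
  rw [interior_Icc]
  have hlt : ∀ t ∈ Ioo 0 b, s * cosh t < 1 := fun t ht ↦
    lt_of_le_of_lt (mul_le_mul_of_nonneg_left (cosh_le_cosh.2 (by
      rw [abs_of_pos ht.1, abs_of_pos (ht.1.trans ht.2)]; exact ht.2.le)) hs.le) hsb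
  have hpos : ∀ t, 0 < s * cosh t := fun t ↦ mul_pos hs (cosh_pos t)
  have hsq : ∀ t ∈ Ioo 0 b, 0 < 1 - (s * cosh t) ^ 2 := fun t ht ↦ by
    nlinarith [hlt t ht, hpos t]
  have hder : ∀ t ∈ Ioo 0 b,
      deriv (fun r ↦ arcsin (s * cosh r)) t = s * sinh t / √(1 - (s * cosh t) ^ 2) := by
    intro t ht
    have h2 := (hasDerivAt_arcsin (by linarith [hpos t] : s * cosh t ≠ -1) (hlt t ht).ne).comp t
      ((hasDerivAt_cosh t).const_mul s)
    exact h2.deriv.trans (by ring)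
  intro x hx y hy hxy
  rw [hder x hx, hder y hy]
  refine div_lt_div₀ (mul_lt_mul_of_pos_left (sinh_lt_sinh.2 hxy) hs) (sqrt_le_sqrt ?_)
    (mul_pos hs (sinh_pos_iff.2 hy.1)).le (sqrt_pos.2 (hsq y hy))
  rw [sub_le_sub_iff_left, sq_le_sq₀ (hpos x).le (hpos y).le]
  refine mul_le_mul_of_nonneg_left (cosh_le_cosh.2 ?_) hs.le
  rw [abs_of_pos hx.1, abs_of_pos hy.1]
  exact hxy.le

/-- Jensen's inequality for the arithmetic mean, with its equality case. -/
lemma jensen_mean {ι : Type*} [Fintype ι] [Nonempty ι] {s : Set ℝ} {f : ℝ → ℝ}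
    (hf : StrictConvexOn ℝ s f) {p : ι → ℝ} (hp : ∀ i, p i ∈ s) :
    Fintype.card ι * f ((∑ i, p i) / Fintype.card ι) ≤ ∑ i, f (p i) ∧
    (∑ i, f (p i) = Fintype.card ι * f ((∑ i, p i) / Fintype.card ι) ↔ ∀ i j, p i = p j) := by
  have hN : 0 < (Fintype.card ι : ℝ) := by exact_mod_cast Fintype.card_pos
  have hw : ∑ _i : ι, (Fintype.card ι : ℝ)⁻¹ = 1 := by
    rw [Finset.sum_const, Finset.card_univ, nsmul_eq_mul, mul_inv_cancel₀ hN.ne']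
  have h1 := hf.convexOn.map_sum_le (t := Finset.univ) (w := fun _ : ι ↦ (Fintype.card ι : ℝ)⁻¹)
    (fun _ _ ↦ by positivity) hw fun i _ ↦ hp i
  have h2 := hf.map_sum_eq_iff_of_pos (t := Finset.univ)
    (w := fun _ : ι ↦ (Fintype.card ι : ℝ)⁻¹) (fun _ _ ↦ by positivity) hw fun i _ ↦ hp i
  simp only [smul_eq_mul, ← Finset.mul_sum, Finset.mem_univ, forall_true_left] at h1 h2
  rw [← div_eq_inv_mul] at h1 h2
  refine ⟨?_, ?_⟩
  · rwa [← le_inv_mul_iff₀ hN]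
  · rw [← h2, eq_inv_mul_iff_mul_eq₀ hN.ne', eq_comm]

lemma mean_mem_Icc {ι : Type*} [Fintype ι] [Nonempty ι] {a b : ℝ} {p : ι → ℝ}
    (hp : ∀ i, p i ∈ Icc a b) : (∑ i, p i) / Fintype.card ι ∈ Icc a b := by
  have hN : 0 < (Fintype.card ι : ℝ) := by exact_mod_cast Fintype.card_pos
  have h1 := Finset.card_nsmul_le_sum Finset.univ p a fun i _ ↦ (hp i).1
  have h2 := Finset.sum_le_card_nsmul Finset.univ p b fun i _ ↦ (hp i).2
  rw [Finset.card_univ, nsmul_eq_mul] at h1 h2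
  exact ⟨by rwa [le_div_iff₀' hN], by rwa [div_le_iff₀' hN]⟩

lemma eq_mean_of_forall_eq {ι : Type*} [Fintype ι] {p : ι → ℝ} (hp : ∀ i j, p i = p j) (i : ι) :
    p i = (∑ j, p j) / Fintype.card ι := by
  have : Nonempty ι := ⟨i⟩
  have hN : (Fintype.card ι : ℝ) ≠ 0 := by exact_mod_cast Fintype.card_ne_zero
  rw [Finset.sum_congr rfl fun j _ ↦ hp j i, Finset.sum_const, Finset.card_univ, nsmul_eq_mul,
    mul_div_cancel_left₀ _ hN]

/-- Among the tangential polygons of given inradius, the regular one has the smallest area. -/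
lemma IsTangentialWithInradius.area_ge {n : ℕ} (hn : 3 ≤ n) {P : Polygon ℍ n} {r : ℝ}
    (hP : IsTangentialWithInradius P r) :
    0 < r ∧ sin (π / n) * cosh r < 1 ∧
    2 * (n * arcsin (sin (π / n) * cosh r)) - 2 * π ≤ area P ∧
    (area P = 2 * (n * arcsin (sin (π / n) * cosh r)) - 2 * π ↔ IsRegular P) := by
  obtain ⟨hr, θ, hθ, hsum, harea, hreg⟩ := hP.exists_angles
  have : Nonempty (Fin n) := ⟨⟨0, by linarith⟩⟩
  -- The largest angle bounds an interval on which the argument of `arcsin` stays below `1`; the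
  -- mean `π / n` lies in it too.
  obtain ⟨m, hm⟩ := Finite.exists_max θ
  have hmem : ∀ i, θ i ∈ Icc 0 (θ m) := fun i ↦ ⟨(hθ i).1.le, hm i⟩
  have hC : 1 < cosh r := one_lt_cosh.2 hr.ne'
  obtain ⟨h1, h2⟩ := jensen_mean
    (strictConvexOn_arcsin_mul_sin hC (hθ m).2.1 (hθ m).2.2) hmem
  have h3 := mean_mem_Icc hmem
  rw [hsum, Fintype.card_fin] at h1 h2 h3
  refine ⟨hr, ?_, ?_, ?_⟩
  · refine lt_of_le_of_lt (mul_le_mul_of_nonneg_right ?_ (cosh_pos r).le) (hθ m).2.2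
    exact sin_le_sin_of_le_of_le_pi_div_two (by linarith [h3.1, pi_pos]) (hθ m).2.1.le h3.2
  · rw [harea]; linarith
  · rw [harea, hreg, ← h2, sub_left_inj, mul_right_inj' two_ne_zero]

end

end

end Hyperbolic

/-! ### The main theorem: Jensen over the inradii -/

theorem theorem8 (n k : ℕ) (hn : 3 ≤ n) (hk : 1 ≤ k) (P : Fin k → Polygon UpperHalfPlane n)
    (r : Fin k → ℝ) (T : ℝ)
    (hP : ∀ i, Hyperbolic.IsTangentialWithInradius (P i) (r i)) (hT : ∑ i, r i = T) :
    Real.sin (Real.pi / n) * Real.cosh (T / k) ≤ 1 ∧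
    (k : ℝ) * ((n : ℝ) - 2) * Real.pi -
        2 * (n : ℝ) * (k : ℝ) * Real.arccos (Real.sin (Real.pi / n) * Real.cosh (T / k)) ≤
      ∑ i, Hyperbolic.area (P i) ∧
    (∑ i, Hyperbolic.area (P i) =
        (k : ℝ) * ((n : ℝ) - 2) * Real.pi -
          2 * (n : ℝ) * (k : ℝ) * Real.arccos (Real.sin (Real.pi / n) * Real.cosh (T / k)) ↔
      ∀ i, Hyperbolic.IsRegular (P i) ∧ r i = T / k) := by
  have : Nonempty (Fin k) := ⟨⟨0, hk⟩⟩
  have hn0 : 0 < (n : ℝ) := by exact_mod_cast (by linarith : 0 < n)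
  have hk0 : 0 < (k : ℝ) := by exact_mod_cast hk
  choose hr hlt hge heq using fun i ↦ (hP i).area_ge hn
  have hs : 0 < Real.sin (Real.pi / n) :=
    Real.sin_pos_of_pos_of_lt_pi (by positivity)
      (div_lt_self Real.pi_pos (by exact_mod_cast (by linarith : 1 < n)))
  obtain ⟨m, hm⟩ := Finite.exists_max r
  have hmem : ∀ i, r i ∈ Set.Icc 0 (r m) := fun i ↦ ⟨(hr i).le, hm i⟩
  obtain ⟨h1, h2⟩ := Hyperbolic.jensen_mean
    (Hyperbolic.strictConvexOn_arcsin_mul_cosh hs (hlt m)) hmem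
  have h3 := Hyperbolic.mean_mem_Icc hmem
  rw [hT, Fintype.card_fin] at h1 h2 h3
  have hbound : (k : ℝ) * ((n : ℝ) - 2) * Real.pi -
      2 * (n : ℝ) * (k : ℝ) * Real.arccos (Real.sin (Real.pi / n) * Real.cosh (T / k)) =
      2 * n * (k * Real.arcsin (Real.sin (Real.pi / n) * Real.cosh (T / k))) -
        k * (2 * Real.pi) := by
    rw [Real.arccos_eq_pi_div_two_sub_arcsin]; ring
  have hsum : ∑ i, (2 * (n * Real.arcsin (Real.sin (Real.pi / n) * Real.cosh (r i))) -
      2 * Real.pi) = 2 * n * ∑ i, Real.arcsin (Real.sin (Real.pi / n) * Real.cosh (r i)) -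
      k * (2 * Real.pi) := by
    rw [Finset.sum_sub_distrib, Finset.sum_const, Finset.card_univ, Fintype.card_fin, nsmul_eq_mul,
      Finset.mul_sum]
    simp only [mul_assoc]
  have hle := Finset.sum_le_sum fun i (_ : i ∈ Finset.univ) ↦ hge i
  have h4 : 2 * n * (k * Real.arcsin (Real.sin (Real.pi / n) * Real.cosh (T / k))) ≤
      2 * n * ∑ i, Real.arcsin (Real.sin (Real.pi / n) * Real.cosh (r i)) :=
    mul_le_mul_of_nonneg_left h1 (by positivity)
  rw [hsum] at hle
  rw [hbound]
  refine ⟨?_, by linarith, fun h ↦ ?_, fun h ↦ ?_⟩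
  · refine le_trans (mul_le_mul_of_nonneg_left ?_ hs.le) (hlt m).le
    rw [Real.cosh_le_cosh, abs_of_nonneg h3.1, abs_of_pos (hr m)]
    exact h3.2
  -- Equality in the total makes both links of the chain equalities: termwise in the areas, giving
  -- regularity, and in Jensen, giving equal inradii.
  · have h5 : ∑ i, Hyperbolic.area (P i) = ∑ i, (2 * (n * Real.arcsin
        (Real.sin (Real.pi / n) * Real.cosh (r i))) - 2 * Real.pi) := by
      rw [hsum]; linarith
    have h6 := (Finset.sum_eq_sum_iff_of_le fun i _ ↦ hge i).1 h5.symm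
    have h7 : ∑ i, Real.arcsin (Real.sin (Real.pi / n) * Real.cosh (r i)) =
        k * Real.arcsin (Real.sin (Real.pi / n) * Real.cosh (T / k)) :=
      mul_left_cancel₀ (by positivity : 2 * (n : ℝ) ≠ 0) (by linarith)
    refine fun i ↦ ⟨(heq i).1 (h6 i (Finset.mem_univ i)).symm, ?_⟩
    rw [Hyperbolic.eq_mean_of_forall_eq (h2.1 h7) i, hT, Fintype.card_fin]
  · rw [Finset.sum_congr rfl fun i _ ↦ (heq i).2 (h i).1, hsum,
      h2.2 fun i j ↦ (h i).2.trans (h j).2.symm]
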